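/- **Setting.** Let $L_1,L_2,b,g,\mu_\pm>0$, $\rho_+>\rho_->0$, $\sigma_\pm\ge 0$, and write $[\rho]:=\rho_+-\rho_-$. Let $\mathrm T^2=(\mathbb R/2\pi L_1\mathbb Z)\times(\mathbb R/2\pi L_2\mathbb Z)$, $\Omega_+=\mathrm T^2\times(0,1)$, $\Omega_-=\mathrm T^2\times(-b,0)$, $\Omega=\Omega_+\cup\Omega_-$, $\Sigma_+=\{x_3=1\}$, $\Sigma_-=\{x_3=0\}$, $\Sigma=\Sigma_+\cup\Sigma_-$, $\Sigma_b=\{x_3=-b\}$. Let $\rho,\mu$ be equal to $\rho_\pm,\mu_\pm$ on $\Omega_\pm$, $\mathbb D(u)_{ij}=\partial_ju_i+\partial_iu_j$, let $\Delta_*$ be the horizontal Laplacian, and $[\![f]\!]=f_+-f_-$ the jump at $x_3=0$. The linearized problem for $(u,p,\eta)$ is $$\begin{cases}\rho\,\partial_tu-\mu\Delta u+\nabla p=0,\quad \operatorname{div}u=0&\text{in }\Omega,\\ \partial_t\eta=u_3&\text{on }\Sigma,\\ (p_+I-\mu_+\mathbb D(u_+))e_3=(\rho_+g\eta_+-\sigma_+\Delta_*\eta_+)e_3&\text{on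 }\Sigma_+,\\ [\![u]\!]=0,\quad[\![pI-\mu\mathbb D(u)]\!]e_3=([\rho]g\eta_-+\sigma_-\Delta_*\eta_-)e_3&\text{on }\Sigma_-,\\ u_-=0&\text{on }\Sigma_b.\end{cases}\tag{L}$$ For an integer $k\ge0$ put $\|u\|_k^2=\|u_+\|_{H^k(\Omega_+)}^2+\|u_-\|_{H^k(\Omega_-)}^2$ and $\|\eta\|_k^2=\|\eta_+\|_{H^k(\mathrm T^2)}^2+\|\eta_-\|_{H^k(\mathrm T^2)}^2$. Let $\sigma_c=g[\rho]\max\{L_1^2,L_2^2\}$ and $|\xi|_c=\sqrt{g[\rho]/\sigma_-}$, with $|\xi|_c=\infty$ if $\sigma_-=0$. For $r,s>0$ and real $\psi\in{}_0H^2(-b,1)=\{\psi\in H^2((-b,1)):\psi(-b)=\psi'(-b)=0\}$ let $$E(\psi;r,s)=\tfrac12\int_{-b}^1s\mu\big(4r^2|\psi'|^2+|r^2\psi+\psi''|^2\big)dx_3+\tfrac12r^2(\sigma_+r^2+g\rho_+)|\psi(1)|^2+\tfrac12r^2(\sigma_-r^2-g[\rho])|\psi(0)|^2,$$ $$J(\psi;r)=\tfrac12\int_{-b}^1\rho\,(r^2|\psi|^2+|\psi'|^2)\,dx_3,\qquad\alpha(r;s)=\inf\{E(\psi;r,s):\psi\in{}_0H^2(-b,1),\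 J(\psi;r)=1\}.$$ **Theorem.** (0) For every real $r$ with $0<r<|\xi|_c$ there is exactly one $s>0$ with $\alpha(r;s)<0$ and $s=\sqrt{-\alpha(r;s)}$. Denote it by $\lambda(r)$, and let $\Lambda$ be the supremum of $\lambda(|\xi|)$ over the frequencies $\xi\in L_1^{-1}\mathbb Z\times L_2^{-1}\mathbb Z$ with $0<|\xi|<|\xi|_c$. (1) If $0<\sigma_-<\sigma_c$, then $0<\Lambda<\infty$ and (L) has a growing normal mode with rate $\Lambda$. (2) If $\sigma_-=0$, then $0<\Lambda<\infty$, some of the values $\lambda(|\xi|)$ of these frequencies lie in $(\Lambda/2,\Lambda]$, and for each such value $\Lambda_*\in(\Lambda/2,\Lambda]$, (L) has a growing normal mode with rate $\Lambda_*$. Here a *growing normal mode with rate $\lambda>0$* consists of a frequency $\xi\in L_1^{-1}\mathbb Z\times L_2^{-1}\mathbb Z$ with $0<|\xi|<|\xi|_c$ and $\lambda(|\xi|)=\lambda$, a minimizer $\psi$ of $E(\cdot\,;|\xi|,\lambda)$ on $\{\psi\in{}_0H^2(-b,1):J(\psi;|\xi|)=1\}$, and real functions $\varphi,\theta,\pi$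 of $x_3$ such that, with $x'=(x_1,x_2)$, $$u=(-i\varphi(x_3),-i\theta(x_3),\psi(x_3))\,e^{ix'\cdot\xi}e^{\lambda t},\qquad p=\pi(x_3)\,e^{ix'\cdot\xi}e^{\lambda t},\qquad\eta=\lambda^{-1}u_3|_\Sigma$$ is a solution of (L) for which $u$ and $p$ are smooth up to the boundary in $\overline{\Omega_\pm}$, $\eta$ is smooth, all Sobolev norms of $u$, $p$, $\eta$ at each time are finite, $\|u(0)\|_k>0$, $\|\eta(0)\|_k>0$, and $$\|\eta(t)\|_k=e^{\lambda t}\|\eta(0)\|_k,\qquad\|u(t)\|_k=e^{\lambda t}\|u(0)\|_k\qquad\text{for all integers }k\ge0\text{ and all }t;$$ and the real part $(\operatorname{Re}u,\operatorname{Re}p,\operatorname{Re}\eta)$ has all these properties as well (solution of (L), smoothness, finite nonzero norms, exact growth). -/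

import Mathlib

open scoped ContDiff

noncomputable section

namespace TwoFluid

/-! ### Physical parameters -/

/-- The two fluid layers. The same labels are used for the surfaces: the upper surface is the
free surface `x₃ = 1`, the lower surface is the internal interface `x₃ = 0`. -/
inductive Side where
  | upper
  | lower

/-- The parameters of the problem: horizontal periods `2πL₁`, `2πL₂`, depth `b` of the lower
fluid, gravity `g`, densities, viscosities and surface tension coefficients
(`p` for the upper fluid, `m` for the lower one). The upper fluid is heavier. -/
structure Params where
  L₁ : ℝ
  L₂ : ℝ
  b : ℝ
  g : ℝ
  ρp : ℝ
  ρm : ℝ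
  μp : ℝ
  μm : ℝ
  σp : ℝ
  σm : ℝ
  hL₁ : 0 < L₁
  hL₂ : 0 < L₂
  hb : 0 < b
  hg : 0 < g
  hρm : 0 < ρm
  hρ : ρm < ρp
  hμp : 0 < μp
  hμm : 0 < μm
  hσp : 0 ≤ σp
  hσm : 0 ≤ σm

namespace Params

variable (P : Params)

def rho : Side → ℝ
  | .upper => P.ρp
  | .lower => P.ρm

def mu : Side → ℝ
  | .upper => P.μp
  | .lower => P.μm

/-- The density jump `ρ₊ - ρ₋`. -/
def rhoJump : ℝ := P.ρp - P.ρm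

/-- The critical surface tension `σ_c = g (ρ₊ - ρ₋) max {L₁², L₂²}`. -/
def sigmaC : ℝ := P.g * P.rhoJump * max (P.L₁ ^ 2) (P.L₂ ^ 2)

/-- The piecewise constant density and viscosity as functions of the height. -/
def rhoAt (x : ℝ) : ℝ := if 0 < x then P.ρp else P.ρm

def muAt (x : ℝ) : ℝ := if 0 < x then P.μp else P.μm

/-- `0 < r < |ξ|_c`, where `|ξ|_c = √(g (ρ₊ - ρ₋) / σ₋)`, and `|ξ|_c = ∞` when `σ₋ = 0`. -/
def IsSubcritical (r : ℝ) : Prop :=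
  0 < r ∧ (P.σm ≠ 0 → r < Real.sqrt (P.g * P.rhoJump / P.σm))

/-- The horizontal frequencies `ξ ∈ L₁⁻¹ℤ × L₂⁻¹ℤ` and their moduli. -/
def freq (m : Fin 2 → ℤ) : Fin 2 → ℝ := ![(m 0 : ℝ) / P.L₁, (m 1 : ℝ) / P.L₂]

def freqAbs (m : Fin 2 → ℤ) : ℝ := Real.sqrt (P.freq m 0 ^ 2 + P.freq m 1 ^ 2)

end Params

/-! ### The variational problem -/

/-- The space of real functions `v ∈ H²((-b,1))` with `v(-b) = v'(-b) = 0`: `v` is represented by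
its `C¹` representative `toFun` on `[-b,1]`, with derivative `d1`, which is absolutely continuous
with derivative `d2 ∈ L²`. -/
structure ZeroH2 (b : ℝ) where
  toFun : ℝ → ℝ
  d1 : ℝ → ℝ
  d2 : ℝ → ℝ
  memLp_d2 : MeasureTheory.MemLp d2 2 (MeasureTheory.volume.restrict (Set.Ioo (-b) 1))
  d1_eq : ∀ x ∈ Set.Icc (-b) 1, d1 x = ∫ t in (-b)..x, d2 t
  toFun_eq : ∀ x ∈ Set.Icc (-b) 1, toFun x = ∫ t in (-b)..x, d1 t

namespace Params

variable (P : Params)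

/-- The energy `E(ψ; r, s)`, where `r` stands for `|ξ|`. -/
def energy (r s : ℝ) (ψ : ZeroH2 P.b) : ℝ :=
  (1 / 2) * (∫ x in (-P.b)..1,
      s * P.muAt x * (4 * r ^ 2 * ψ.d1 x ^ 2 + (r ^ 2 * ψ.toFun x + ψ.d2 x) ^ 2))
    + (1 / 2) * r ^ 2 * (P.σp * r ^ 2 + P.g * P.ρp) * ψ.toFun 1 ^ 2
    + (1 / 2) * r ^ 2 * (P.σm * r ^ 2 - P.g * P.rhoJump) * ψ.toFun 0 ^ 2

/-- The constraint functional `J(ψ; r)`. -/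
def constr (r : ℝ) (ψ : ZeroH2 P.b) : ℝ :=
  (1 / 2) * ∫ x in (-P.b)..1, P.rhoAt x * (r ^ 2 * ψ.toFun x ^ 2 + ψ.d1 x ^ 2)

/-- `α(r; s) = inf {E(ψ; r, s) : J(ψ; r) = 1}`. -/
def alpha (r s : ℝ) : ℝ := sInf (P.energy r s '' {ψ | P.constr r ψ = 1})

/-- `ψ` attains the infimum of `E(·; r, s)` on `{J(·; r) = 1}`. -/
def IsMinimizer (r s : ℝ) (ψ : ZeroH2 P.b) : Prop :=
  P.constr r ψ = 1 ∧ ∀ χ : ZeroH2 P.b, P.constr r χ = 1 → P.energy r s ψ ≤ P.energy r s χ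

/-- `s` is a fixed point of `s ↦ λ(r; s) = √(-α(r; s))` on the set where `α(r; s) < 0`,
i.e. `s` is the growth rate `λ(r)`. -/
def IsGrowthRate (r s : ℝ) : Prop :=
  0 < s ∧ P.alpha r s < 0 ∧ s = Real.sqrt (-P.alpha r s)

/-- The growth rates `λ(|ξ|)` of the frequencies `ξ ∈ L₁⁻¹ℤ × L₂⁻¹ℤ` with `0 < |ξ| < |ξ|_c`. -/
def growthRates : Set ℝ :=
  {s | ∃ m : Fin 2 → ℤ, P.IsSubcritical (P.freqAbs m) ∧ P.IsGrowthRate (P.freqAbs m) s}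

/-- The largest growth rate `Λ`. -/
def Lam : ℝ := sSup P.growthRates

end Params

/-! ### Derivatives and Sobolev norms of functions that are smooth up to the boundary -/

section Sobolev

variable {n : ℕ} {F : Type*} [NormedAddCommGroup F] [NormedSpace ℝ F]

/-- The partial derivative `∂ᵢ f` within a set `S`. At a boundary point of a closed slab this is
the boundary value of the derivative from inside. -/
def pd (S : Set (Fin n → ℝ)) (i : Fin n) (f : (Fin n → ℝ) → F) (x : Fin n → ℝ) : F :=
  fderivWithin ℝ f S x (Pi.single i 1)

/-- The mixed partial derivative `∂^α f`. -/
def mixedPd (S : Set (Fin n → ℝ)) (α : Fin n → ℕ) (f : (Fin n → ℝ) → F) : (Fin n → ℝ) → F :=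
  (List.finRange n).foldr (fun i h => (pd S i)^[α i] h) f

/-- The multi-indices `α ∈ ℕⁿ` with `|α| ≤ k`. -/
def multiIndices (n k : ℕ) : Finset (Fin n → ℕ) :=
  (Fintype.piFinset fun _ => Finset.range (k + 1)).filter fun α => ∑ i, α i ≤ k

/-- All derivatives of order at most `k` lie in `L²(D)`. -/
def MemHk (S D : Set (Fin n → ℝ)) (k : ℕ) (f : (Fin n → ℝ) → F) : Prop :=
  ∀ α ∈ multiIndices n k,
    MeasureTheory.MemLp (mixedPd S α f) 2 (MeasureTheory.volume.restrict D)

/-- The squared norm `‖f‖²_{H^k(D)} = ∑_{|α| ≤ k} ∫_D |∂^α f|²`. -/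
def hkNormSq (S D : Set (Fin n → ℝ)) (k : ℕ) (f : (Fin n → ℝ) → F) : ℝ :=
  ∑ α ∈ multiIndices n k, ∫ x in D, ‖mixedPd S α f x‖ ^ 2

end Sobolev

/-! ### The linearized problem

Functions on `T² × I` are functions on `ℝ² × I` that are periodic with periods `2πL₁`, `2πL₂` in
the first two variables. The coordinates `x₁, x₂, x₃` have the indices `0, 1, 2`. -/

namespace Params

variable (P : Params)

/-- The range of heights of the two fluids. -/
def bot : Side → ℝ
  | .upper => 0
  | .lower => -P.b

def top : Side → ℝ
  | .upper => 1
  | .lower => 0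

/-- The closed slab over `ℝ²` occupied by a fluid. -/
def slab (s : Side) : Set (Fin 3 → ℝ) := {x | x 2 ∈ Set.Icc (P.bot s) (top s)}

/-- The open slab over `ℝ²`. -/
def openSlab (s : Side) : Set (Fin 3 → ℝ) := {x | x 2 ∈ Set.Ioo (P.bot s) (top s)}

/-- One period cell of the horizontal torus. -/
def torusCell : Set (Fin 2 → ℝ) :=
  {y | y 0 ∈ Set.Ioo 0 (2 * Real.pi * P.L₁) ∧ y 1 ∈ Set.Ioo 0 (2 * Real.pi * P.L₂)}

/-- One period cell of the fluid domain `Ω₊` or `Ω₋`. -/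
def cell (s : Side) : Set (Fin 3 → ℝ) := {x | ![x 0, x 1] ∈ P.torusCell} ∩ P.openSlab s

/-- The point `(y, h)`. -/
def at_ (y : Fin 2 → ℝ) (h : ℝ) : Fin 3 → ℝ := ![y 0, y 1, h]

variable {F : Type*} [NormedAddCommGroup F] [NormedSpace ℝ F]

/-- Components `D(v)ᵢⱼ = ∂ⱼvᵢ + ∂ᵢvⱼ` in the fluid `s`. -/
def symGrad (s : Side) (v : (Fin 3 → ℝ) → Fin 3 → F) (i j : Fin 3) (x : Fin 3 → ℝ) : F :=
  pd (P.slab s) j (fun z => v z i) x + pd (P.slab s) i (fun z => v z j) x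

/-- The vector `(q I - μ D(v)) e₃` in the fluid `s`. -/
def stress (s : Side) (v : (Fin 3 → ℝ) → Fin 3 → F) (q : (Fin 3 → ℝ) → F) (i : Fin 3)
    (x : Fin 3 → ℝ) : F :=
  (if i = 2 then q x else 0) - P.mu s • P.symGrad s v i 2 x

/-- The horizontal Laplacian. -/
def lapStar (h : (Fin 2 → ℝ) → F) (y : Fin 2 → ℝ) : F :=
  ∑ j : Fin 2, pd Set.univ j (pd Set.univ j h) y

/-- `(u, p, η)` is a solution (for all times `t ∈ ℝ`) of the linearized two-phase problem, with
`u`, `p` smooth up to the boundary in each fluid. -/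
structure IsSolution (u : Side → ℝ → (Fin 3 → ℝ) → Fin 3 → F) (p : Side → ℝ → (Fin 3 → ℝ) → F)
    (η : Side → ℝ → (Fin 2 → ℝ) → F) : Prop where
  smooth_u : ∀ s i, ContDiffOn ℝ ∞ (fun q : ℝ × (Fin 3 → ℝ) => u s q.1 q.2 i)
    (Set.univ ×ˢ P.slab s)
  smooth_p : ∀ s, ContDiffOn ℝ ∞ (fun q : ℝ × (Fin 3 → ℝ) => p s q.1 q.2)
    (Set.univ ×ˢ P.slab s)
  smooth_η : ∀ s, ContDiff ℝ ∞ (fun q : ℝ × (Fin 2 → ℝ) => η s q.1 q.2)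
  periodic_u : ∀ s t, ∀ x ∈ P.slab s,
    u s t (x + Pi.single 0 (2 * Real.pi * P.L₁)) = u s t x ∧
    u s t (x + Pi.single 1 (2 * Real.pi * P.L₂)) = u s t x
  periodic_p : ∀ s t, ∀ x ∈ P.slab s,
    p s t (x + Pi.single 0 (2 * Real.pi * P.L₁)) = p s t x ∧
    p s t (x + Pi.single 1 (2 * Real.pi * P.L₂)) = p s t x
  periodic_η : ∀ s t y,
    η s t (y + Pi.single 0 (2 * Real.pi * P.L₁)) = η s t y ∧
    η s t (y + Pi.single 1 (2 * Real.pi * P.L₂)) = η s t y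
  momentum : ∀ s t, ∀ x ∈ P.openSlab s, ∀ i,
    P.rho s • deriv (fun τ => u s τ x i) t
      - P.mu s • (∑ j : Fin 3, pd (P.slab s) j (pd (P.slab s) j (fun z => u s t z i)) x)
      + pd (P.slab s) i (p s t) x = 0
  div_free : ∀ s t, ∀ x ∈ P.openSlab s,
    ∑ j : Fin 3, pd (P.slab s) j (fun z => u s t z j) x = 0
  kinematic : ∀ s t y, deriv (fun τ => η s τ y) t = u s t (at_ y (top s)) 2
  stress_top : ∀ t y i, P.stress .upper (u .upper t) (p .upper t) i (at_ y 1) =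
    if i = 2 then (P.ρp * P.g) • η .upper t y - P.σp • lapStar (η .upper t) y else 0
  jump_u : ∀ t y, u .upper t (at_ y 0) = u .lower t (at_ y 0)
  jump_stress : ∀ t y i, P.stress .upper (u .upper t) (p .upper t) i (at_ y 0)
      - P.stress .lower (u .lower t) (p .lower t) i (at_ y 0) =
    if i = 2 then (P.rhoJump * P.g) • η .lower t y + P.σm • lapStar (η .lower t) y else 0
  no_slip : ∀ t y, u .lower t (at_ y (-P.b)) = 0

/-- The piecewise Sobolev norm of order `k` of a velocity field on `Ω = Ω₊ ∪ Ω₋`. -/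
def bulkNorm (k : ℕ) (v : Side → (Fin 3 → ℝ) → Fin 3 → F) : ℝ :=
  Real.sqrt (∑ i : Fin 3, hkNormSq (P.slab .upper) (P.cell .upper) k (fun x => v .upper x i)
    + ∑ i : Fin 3, hkNormSq (P.slab .lower) (P.cell .lower) k (fun x => v .lower x i))

/-- The Sobolev norm of order `k` of a pair of surface functions on `Σ = Σ₊ ∪ Σ₋`. -/
def surfNorm (k : ℕ) (h : Side → (Fin 2 → ℝ) → F) : ℝ :=
  Real.sqrt (hkNormSq Set.univ P.torusCell k (h .upper)
    + hkNormSq Set.univ P.torusCell k (h .lower))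

/-- `(u, p, η)` is a solution of the linearized problem that belongs to the Sobolev spaces of all
orders, is nonzero, and whose norms of every order grow exactly like `e^{lam t}`. -/
structure IsGrowingSolution (lam : ℝ) (u : Side → ℝ → (Fin 3 → ℝ) → Fin 3 → F)
    (p : Side → ℝ → (Fin 3 → ℝ) → F) (η : Side → ℝ → (Fin 2 → ℝ) → F) : Prop where
  solution : P.IsSolution u p η
  memHk_u : ∀ k s t i, MemHk (P.slab s) (P.cell s) k (fun x => u s t x i)
  memHk_p : ∀ k s t, MemHk (P.slab s) (P.cell s) k (p s t)
  memHk_η : ∀ k s t, MemHk Set.univ P.torusCell k (η s t)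
  pos_η : ∀ k, 0 < P.surfNorm k (fun s => η s 0)
  pos_u : ∀ k, 0 < P.bulkNorm k (fun s => u s 0)
  growth_η : ∀ k t,
    P.surfNorm k (fun s => η s t) = Real.exp (lam * t) * P.surfNorm k (fun s => η s 0)
  growth_u : ∀ k t,
    P.bulkNorm k (fun s => u s t) = Real.exp (lam * t) * P.bulkNorm k (fun s => u s 0)

end Params

/-! ### Normal modes -/

/-- The factor `e^{lam t} e^{i x'·ξ}`. -/
def wave (lam : ℝ) (ξ : Fin 2 → ℝ) (t x₁ x₂ : ℝ) : ℂ :=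
  Complex.exp ((lam * t : ℝ) : ℂ) * Complex.exp (Complex.I * ((x₁ * ξ 0 + x₂ * ξ 1 : ℝ) : ℂ))

/-- `u = (-iφ(x₃), -iθ(x₃), ψ(x₃)) e^{i x'·ξ} e^{lam t}`. -/
def modeU (lam : ℝ) (ξ : Fin 2 → ℝ) (φ θ ψ : ℝ → ℝ) :
    Side → ℝ → (Fin 3 → ℝ) → Fin 3 → ℂ :=
  fun _ t x i => ![-Complex.I * (φ (x 2) : ℂ), -Complex.I * (θ (x 2) : ℂ), (ψ (x 2) : ℂ)] i
    * wave lam ξ t (x 0) (x 1)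

/-- `p = π(x₃) e^{i x'·ξ} e^{lam t}`, where `π` is given separately in the two fluids. -/
def modeP (lam : ℝ) (ξ : Fin 2 → ℝ) (π : Side → ℝ → ℝ) : Side → ℝ → (Fin 3 → ℝ) → ℂ :=
  fun s t x => (π s (x 2) : ℂ) * wave lam ξ t (x 0) (x 1)

/-- `η = lam⁻¹ u₃` on the two surfaces. -/
def modeEta (lam : ℝ) (ξ : Fin 2 → ℝ) (ψ : ℝ → ℝ) : Side → ℝ → (Fin 2 → ℝ) → ℂ :=
  fun s t y => ((lam⁻¹ * ψ (Params.top s) : ℝ) : ℂ) * wave lam ξ t (y 0) (y 1)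

/-- There is a growing normal mode with rate `lam`: for some frequency
`ξ ∈ L₁⁻¹ℤ × L₂⁻¹ℤ` with `0 < |ξ| < |ξ|_c`, whose growth rate `λ(|ξ|)` is `lam`, and some minimizer
`ψ` of `E(·; |ξ|, lam)` on `{J = 1}`, there are profiles `φ, θ, π` such that the corresponding
complex normal mode, and also its real part, are growing solutions of the linearized problem. -/
def Params.HasGrowingMode (P : Params) (lam : ℝ) : Prop :=
  ∃ (m : Fin 2 → ℤ) (ψ : ZeroH2 P.b) (φ θ : ℝ → ℝ) (π : Side → ℝ → ℝ),
    P.IsSubcritical (P.freqAbs m) ∧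
    P.IsGrowthRate (P.freqAbs m) lam ∧
    P.IsMinimizer (P.freqAbs m) lam ψ ∧
    P.IsGrowingSolution lam (modeU lam (P.freq m) φ θ ψ.toFun) (modeP lam (P.freq m) π)
      (modeEta lam (P.freq m) ψ.toFun) ∧
    P.IsGrowingSolution lam
      (fun s t x i => (modeU lam (P.freq m) φ θ ψ.toFun s t x i).re)
      (fun s t x => (modeP lam (P.freq m) π s t x).re)
      (fun s t y => (modeEta lam (P.freq m) ψ.toFun s t y).re)

end TwoFluid

end

/-!
# Growing normal modes of the linearized two-fluid problem

Let `s` be a growth rate at the modulus `r`, so that `α(r; s) = -s²`. Then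
`E(ψ; r, s) + s² J(ψ; r) = (B(ψ, ψ) - c ψ(0)²) / 2`, where `B` is a positive definite form on
`₀H²(-b,1)` (`Params.form`) and `c = r² (g [ρ] - σ₋ r²) > 0` below the critical frequency: the
only destabilizing contribution is a point evaluation at the interface. The minimizer is therefore
a multiple of the Riesz representative `w` of `χ ↦ χ(0)` with respect to `B`. Indeed, by the
Cauchy–Schwarz inequality `χ(0)² ≤ w(0) B(χ, χ)`, the infimum `α(r; s)` equals `-s²` only if
`c w(0) = 1`, and then `E + s² J` is nonnegative and vanishes at `w`
(`IsGrowthRate.of_representative`).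

The representative is found explicitly. In each layer the Euler–Lagrange equation has constant
coefficients and the characteristic exponents `±r`, `±√(r² + sρ/μ)`, so `w` is given by eight
coefficients subject to eight linear boundary and transmission conditions. A solution of the
homogeneous conditions satisfies `B(w, w) = 0` and is trivial, so the system is solvable
(`exists_isBvpSolution`). The minimizer is thus smooth up to the boundary in each layer, and the
natural boundary conditions are the stress conditions of the linearized problem
(`IsBvpSolution.isSolution`). Both the mode and its real part are `e^{lam t}` times their initial
values, which gives the exact growth of the norms (`IsSolution.isGrowingSolution`).

The growth rate at `r` is the zero of `s ↦ α(r; s) + s²`. It exists because `α(r; ·)` is an infimum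
of affine functions, hence concave and continuous, and it is unique because `α(r; ·)` is
nondecreasing. As `ψ(0)² = 2 ∫ ψψ'`, the terms `r² ψ²` of `J` and `s μ r² ψ'²` of `E` control
`r² ψ(0)²` uniformly in `r`; this bounds all growth rates (`neg_energyBound_mul_le`). With positive
surface tension only finitely many frequencies are subcritical, so that the supremum is attained.
-/

noncomputable section

namespace TwoFluid

open MeasureTheory Set

/-! ### Functions of class `H²` vanishing to first order at the bottom -/

/-- Integration by parts for two functions that are integrals of their derivatives. -/
lemma integral_mul_add_mul_of_eq_integral {a b : ℝ} (hab : a ≤ b) {F f G g : ℝ → ℝ}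
    (hf : IntervalIntegrable f volume a b) (hg : IntervalIntegrable g volume a b)
    (hF : ∀ x ∈ Icc a b, F x = F a + ∫ t in a..x, f t)
    (hG : ∀ x ∈ Icc a b, G x = G a + ∫ t in a..x, g t) :
    ∫ x in a..b, (f x * G x + F x * g x) = F b * G b - F a * G a := by
  have hac : ∀ {h : ℝ → ℝ} (c : ℝ), IntervalIntegrable h volume a b →
      AbsolutelyContinuousOnInterval (fun x => c + ∫ t in a..x, h t) a b := by
    intro h c hh
    have h1 : AbsolutelyContinuousOnInterval (fun _ : ℝ => c) a b :=
      ((LipschitzWith.const c).lipschitzOnWith (s := uIcc a b)).absolutelyContinuousOnInterval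
    exact h1.add (hh.absolutelyContinuousOnInterval_intervalIntegral (by simp))
  have key := (hac (F a) hf).integral_deriv_mul_eq_sub (hac (G a) hg)
  rw [← hF b ⟨hab, le_rfl⟩, ← hG b ⟨hab, le_rfl⟩] at key
  simp only [intervalIntegral.integral_same, add_zero] at key
  rw [← key]
  apply intervalIntegral.integral_congr_ae
  filter_upwards [hf.ae_hasDerivAt_integral, hg.ae_hasDerivAt_integral] with x h1 h2 hx
  have hx' : x ∈ uIcc a b := uIoc_subset_uIcc hx
  have hx'' : x ∈ Icc a b := by rwa [uIcc_of_le hab] at hx'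
  rw [((h1 hx' a (by simp)).const_add (F a)).deriv, ((h2 hx' a (by simp)).const_add (G a)).deriv,
    ← hF x hx'', ← hG x hx'']

namespace ZeroH2

variable {b : ℝ} (ψ χ : ZeroH2 b)

lemma intervalIntegrable_d2 (hb : 0 < b) : IntervalIntegrable ψ.d2 volume (-b) 1 := by
  rw [intervalIntegrable_iff_integrableOn_Ioo_of_le (by linarith)]
  exact ψ.memLp_d2.integrable one_le_two

lemma continuousOn_of_eq_integral (hb : 0 < b) {F f : ℝ → ℝ}
    (hf : IntervalIntegrable f volume (-b) 1) (h : ∀ x ∈ Icc (-b) 1, F x = ∫ t in (-b)..x, f t) :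
    ContinuousOn F (Icc (-b) 1) := by
  have := intervalIntegral.continuousOn_primitive_interval' hf (left_mem_uIcc)
  rw [uIcc_of_le (by linarith)] at this
  exact this.congr h

lemma continuousOn_d1 (hb : 0 < b) : ContinuousOn ψ.d1 (Icc (-b) 1) :=
  continuousOn_of_eq_integral hb (ψ.intervalIntegrable_d2 hb) ψ.d1_eq

lemma intervalIntegrable_d1 (hb : 0 < b) : IntervalIntegrable ψ.d1 volume (-b) 1 := by
  apply ContinuousOn.intervalIntegrable
  rw [uIcc_of_le (by linarith)]
  exact ψ.continuousOn_d1 hb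

lemma continuousOn_toFun (hb : 0 < b) : ContinuousOn ψ.toFun (Icc (-b) 1) :=
  continuousOn_of_eq_integral hb (ψ.intervalIntegrable_d1 hb) ψ.toFun_eq

lemma toFun_bot (hb : 0 < b) : ψ.toFun (-b) = 0 := by
  rw [ψ.toFun_eq (-b) ⟨le_rfl, by linarith⟩, intervalIntegral.integral_same]

lemma d1_bot (hb : 0 < b) : ψ.d1 (-b) = 0 := by
  rw [ψ.d1_eq (-b) ⟨le_rfl, by linarith⟩, intervalIntegral.integral_same]

lemma memLp_of_continuousOn {f : ℝ → ℝ} (hf : ContinuousOn f (Icc (-b) 1)) :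
    MemLp f 2 (volume.restrict (Ioo (-b) 1)) := by
  obtain ⟨C, hC⟩ := isCompact_Icc.exists_bound_of_continuousOn hf
  refine MemLp.of_bound ((hf.mono Ioo_subset_Icc_self).aestronglyMeasurable measurableSet_Ioo) C ?_
  filter_upwards [ae_restrict_mem measurableSet_Ioo] with x hx
  exact hC x (Ioo_subset_Icc_self hx)

lemma memLp_toFun (hb : 0 < b) : MemLp ψ.toFun 2 (volume.restrict (Ioo (-b) 1)) :=
  memLp_of_continuousOn (ψ.continuousOn_toFun hb)

lemma memLp_d1 (hb : 0 < b) : MemLp ψ.d1 2 (volume.restrict (Ioo (-b) 1)) :=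
  memLp_of_continuousOn (ψ.continuousOn_d1 hb)

/-- An integral from the bottom, rewritten as an integral from another base point. -/
lemma eq_add_integral {F f : ℝ → ℝ}
    (hf : IntervalIntegrable f volume (-b) 1) (h : ∀ x ∈ Icc (-b) 1, F x = ∫ t in (-b)..x, f t)
    {u v : ℝ} (hu : -b ≤ u) (hv : v ≤ 1) :
    ∀ x ∈ Icc u v, F x = F u + ∫ t in u..x, f t := by
  intro x hx
  have h1 : u ≤ 1 := hx.1.trans (hx.2.trans hv)
  have hb1 : (-b) ≤ 1 := hu.trans h1
  rw [h x ⟨hu.trans hx.1, hx.2.trans hv⟩, h u ⟨hu, h1⟩, intervalIntegral.integral_add_adjacent_intervals]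
  · exact hf.mono_set (uIcc_subset_uIcc (by simp) (by rw [uIcc_of_le hb1]; exact ⟨hu, h1⟩))
  · exact hf.mono_set (uIcc_subset_uIcc (by rw [uIcc_of_le hb1]; exact ⟨hu, h1⟩)
      (by rw [uIcc_of_le hb1]; exact ⟨hu.trans hx.1, hx.2.trans hv⟩))

lemma toFun_eq_add (hb : 0 < b) {u v : ℝ} (hu : -b ≤ u) (hv : v ≤ 1) :
    ∀ x ∈ Icc u v, ψ.toFun x = ψ.toFun u + ∫ t in u..x, ψ.d1 t :=
  eq_add_integral (ψ.intervalIntegrable_d1 hb) ψ.toFun_eq hu hv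

lemma d1_eq_add (hb : 0 < b) {u v : ℝ} (hu : -b ≤ u) (hv : v ≤ 1) :
    ∀ x ∈ Icc u v, ψ.d1 x = ψ.d1 u + ∫ t in u..x, ψ.d2 t :=
  eq_add_integral (ψ.intervalIntegrable_d2 hb) ψ.d1_eq hu hv

/-- Scalar multiples in `ZeroH2`. -/
def smul (c : ℝ) : ZeroH2 b where
  toFun x := c * ψ.toFun x
  d1 x := c * ψ.d1 x
  d2 x := c * ψ.d2 x
  memLp_d2 := ψ.memLp_d2.const_mul c
  d1_eq x hx := by rw [intervalIntegral.integral_const_mul, ψ.d1_eq x hx]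
  toFun_eq x hx := by rw [intervalIntegral.integral_const_mul, ψ.toFun_eq x hx]

/-- A bounded measurable coefficient times two square integrable functions is integrable. -/
lemma intervalIntegrable_coeff_mul_mul (hb : 0 < b) {c f g : ℝ → ℝ} (hc : Measurable c)
    {C : ℝ} (hC : ∀ x, |c x| ≤ C)
    (hf : MemLp f 2 (volume.restrict (Ioo (-b) 1)))
    (hg : MemLp g 2 (volume.restrict (Ioo (-b) 1))) :
    IntervalIntegrable (fun x => c x * (f x * g x)) volume (-b) 1 := by
  rw [intervalIntegrable_iff_integrableOn_Ioo_of_le (by linarith)]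
  exact (hf.integrable_mul hg).bdd_mul hc.aestronglyMeasurable (Filter.Eventually.of_forall hC)

end ZeroH2

/-! ### Profiles given by two smooth functions -/

lemma memLp_ite {b : ℝ} {f g : ℝ → ℝ} (hf : Continuous f) (hg : Continuous g) :
    MemLp (fun x => if 0 < x then f x else g x) 2 (volume.restrict (Ioo (-b) 1)) := by
  have hm : (fun x : ℝ => if 0 < x then f x else g x) = (Ioi 0).piecewise f g := by
    funext x
    by_cases hx : 0 < x <;> simp [Set.piecewise, hx]
  rw [hm]
  exact MemLp.piecewise measurableSet_Ioi
    ((ZeroH2.memLp_of_continuousOn hf.continuousOn).restrict _)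
    ((ZeroH2.memLp_of_continuousOn hg.continuousOn).restrict _)

/-- The fundamental theorem of calculus for a function with a kink at `0`. -/
lemma ite_eq_integral_ite {b x : ℝ} (hb : 0 < b) {f f' g g' : ℝ → ℝ}
    (hf : ∀ x, HasDerivAt f (f' x) x) (hg : ∀ x, HasDerivAt g (g' x) x)
    (hf' : Continuous f') (hg' : Continuous g') (h0 : f 0 = g 0) (hgb : g (-b) = 0)
    (hx : x ∈ Icc (-b) 1) :
    (if 0 < x then f x else g x) = ∫ t in (-b)..x, if 0 < t then f' t else g' t := by
  have hfc : Continuous f := continuous_iff_continuousAt.2 fun x => (hf x).continuousAt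
  have hgc : Continuous g := continuous_iff_continuousAt.2 fun x => (hg x).continuousAt
  rw [integral_eq_of_hasDerivAt_off_countable_of_le (fun x => if 0 < x then f x else g x) _
    hx.1 (countable_singleton (0 : ℝ))]
  · simp [hgb, not_lt.2 hb.le]
  · refine (Continuous.if_le (f := id) (g := fun _ => (0 : ℝ)) hgc hfc continuous_id
      continuous_const (by rintro x rfl; exact h0.symm)).continuousOn.congr ?_
    intro x _
    by_cases h : 0 < x
    · simp [h, not_le.2 h]
    · simp [h, not_lt.1 h]
  · rintro y ⟨-, hy⟩
    rcases lt_or_gt_of_ne hy with h | h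
    · simp only [not_lt.2 h.le, if_false]
      refine (hg y).congr_of_eventuallyEq ?_
      filter_upwards [Iio_mem_nhds h] with z hz
      simp [not_lt.2 (mem_Iio.1 hz).le]
    · simp only [h, if_true]
      refine (hf y).congr_of_eventuallyEq ?_
      filter_upwards [Ioi_mem_nhds h] with z hz using by simp [mem_Ioi.1 hz]
  · rw [intervalIntegrable_iff_integrableOn_Ioc_of_le hx.1]
    have h1 : MemLp (fun x => if 0 < x then f' x else g' x) 2 (volume.restrict (Ioo (-b) 1)) :=
      memLp_ite hf' hg'
    have h2 := (integrableOn_Ioc_iff_integrableOn_Ioo (by simp)).2 (h1.integrable one_le_two)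
    exact h2.mono_set (Ioc_subset_Ioc_right hx.2)

/-- The element of `₀H²(-b,1)` equal to `f 0` on `(0,1]` and to `g 0` on `[-b,0]`, for functions
whose values and first derivatives agree at `0`. The families `f`, `g` list the derivatives. -/
def ZeroH2.glue {b : ℝ} (hb : 0 < b) (f g : ℕ → ℝ → ℝ)
    (hf : ∀ k x, HasDerivAt (f k) (f (k + 1) x) x) (hg : ∀ k x, HasDerivAt (g k) (g (k + 1) x) x)
    (h0 : f 0 0 = g 0 0) (h1 : f 1 0 = g 1 0) (hb0 : g 0 (-b) = 0) (hb1 : g 1 (-b) = 0) :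
    ZeroH2 b where
  toFun x := if 0 < x then f 0 x else g 0 x
  d1 x := if 0 < x then f 1 x else g 1 x
  d2 x := if 0 < x then f 2 x else g 2 x
  memLp_d2 := memLp_ite (continuous_iff_continuousAt.2 fun x => (hf 2 x).continuousAt)
    (continuous_iff_continuousAt.2 fun x => (hg 2 x).continuousAt)
  d1_eq _ hx := ite_eq_integral_ite hb (hf 1) (hg 1)
    (continuous_iff_continuousAt.2 fun x => (hf 2 x).continuousAt)
    (continuous_iff_continuousAt.2 fun x => (hg 2 x).continuousAt) h1 hb1 hx
  toFun_eq _ hx := ite_eq_integral_ite hb (hf 0) (hg 0)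
    (continuous_iff_continuousAt.2 fun x => (hf 1 x).continuousAt)
    (continuous_iff_continuousAt.2 fun x => (hg 1 x).continuousAt) h0 hb0 hx

/-- The iterated derivatives of the polynomial `(x + b)² (1 - x)`. -/
def testDeriv (b : ℝ) (k : ℕ) (x : ℝ) : ℝ :=
  (Polynomial.derivative^[k] ((Polynomial.X + Polynomial.C b) ^ 2 * (1 - Polynomial.X))).eval x

lemma hasDerivAt_testDeriv (b : ℝ) (k : ℕ) (x : ℝ) :
    HasDerivAt (testDeriv b k) (testDeriv b (k + 1) x) x := by
  unfold testDeriv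
  rw [Function.iterate_succ_apply']
  exact Polynomial.hasDerivAt _ _

/-- The test function `(x + b)² (1 - x)`, which vanishes at the free surface but not at the
internal interface. -/
def testFun {b : ℝ} (hb : 0 < b) : ZeroH2 b :=
  ZeroH2.glue hb (testDeriv b) (testDeriv b) (hasDerivAt_testDeriv b) (hasDerivAt_testDeriv b)
    rfl rfl (by simp [testDeriv]) (by simp [testDeriv, Polynomial.derivative_pow])

lemma testFun_zero {b : ℝ} (hb : 0 < b) : (testFun hb).toFun 0 = b ^ 2 := by
  simp [testFun, ZeroH2.glue, testDeriv]

lemma testFun_one {b : ℝ} (hb : 0 < b) : (testFun hb).toFun 1 = 0 := by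
  simp [testFun, ZeroH2.glue, testDeriv]

/-! ### The energy as a quadratic form -/

namespace Params

variable (P : Params)

lemma measurable_muAt : Measurable P.muAt :=
  Measurable.ite measurableSet_Ioi measurable_const measurable_const

lemma measurable_rhoAt : Measurable P.rhoAt :=
  Measurable.ite measurableSet_Ioi measurable_const measurable_const

lemma muAt_pos (x : ℝ) : 0 < P.muAt x := by
  unfold muAt; split_ifs; exacts [P.hμp, P.hμm]

lemma hρp : 0 < P.ρp := P.hρm.trans P.hρ

lemma rhoAt_pos (x : ℝ) : 0 < P.rhoAt x := by
  unfold rhoAt; split_ifs; exacts [P.hρp, P.hρm]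

lemma le_rhoAt (x : ℝ) : P.ρm ≤ P.rhoAt x := by
  unfold rhoAt; split_ifs; exacts [P.hρ.le, le_rfl]

lemma abs_muAt_le (x : ℝ) : |P.muAt x| ≤ max P.μp P.μm := by
  rw [abs_of_pos (P.muAt_pos x)]
  unfold muAt; split_ifs; exacts [le_max_left _ _, le_max_right _ _]

lemma abs_rhoAt_le (x : ℝ) : |P.rhoAt x| ≤ P.ρp := by
  rw [abs_of_pos (P.rhoAt_pos x)]
  unfold rhoAt; split_ifs; exacts [le_rfl, P.hρ.le]

lemma rhoJump_pos : 0 < P.rhoJump := sub_pos.2 P.hρ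

/-- The density of the viscous form. -/
def viscDensity (r : ℝ) (ψ χ : ZeroH2 P.b) (x : ℝ) : ℝ :=
  P.muAt x * (4 * r ^ 2 * (ψ.d1 x * χ.d1 x)
    + (r ^ 2 * ψ.toFun x + ψ.d2 x) * (r ^ 2 * χ.toFun x + χ.d2 x))

/-- The density of the kinetic form. -/
def kinDensity (r : ℝ) (ψ χ : ZeroH2 P.b) (x : ℝ) : ℝ :=
  P.rhoAt x * (r ^ 2 * (ψ.toFun x * χ.toFun x) + ψ.d1 x * χ.d1 x)

/-- The viscous bilinear form. -/
def visc (r : ℝ) (ψ χ : ZeroH2 P.b) : ℝ := ∫ x in (-P.b)..1, P.viscDensity r ψ χ x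

/-- The kinetic bilinear form. -/
def kin (r : ℝ) (ψ χ : ZeroH2 P.b) : ℝ := ∫ x in (-P.b)..1, P.kinDensity r ψ χ x

/-- The positive definite bilinear form `B` for which
`E(ψ; r, s) + s² J(ψ; r) = (B(ψ, ψ) - r² (g [ρ] - σ₋ r²) ψ(0)²) / 2`. -/
def form (r s : ℝ) (ψ χ : ZeroH2 P.b) : ℝ :=
  s * P.visc r ψ χ + s ^ 2 * P.kin r ψ χ
    + r ^ 2 * (P.σp * r ^ 2 + P.g * P.ρp) * (ψ.toFun 1 * χ.toFun 1)

/-- The coefficient `r² (g [ρ] - σ₋ r²)` of the destabilizing interface term. -/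
def interfaceCoeff (r : ℝ) : ℝ := r ^ 2 * (P.g * P.rhoJump - P.σm * r ^ 2)

lemma neg_b_le_one : -P.b ≤ 1 := by linarith [P.hb]

lemma intervalIntegrable_viscDensity (r : ℝ) (ψ χ : ZeroH2 P.b) :
    IntervalIntegrable (P.viscDensity r ψ χ) volume (-P.b) 1 := by
  have hh : ∀ φ : ZeroH2 P.b, MemLp (fun x => r ^ 2 * φ.toFun x + φ.d2 x) 2
      (volume.restrict (Ioo (-P.b) 1)) :=
    fun φ => ((φ.memLp_toFun P.hb).const_mul (r ^ 2)).add φ.memLp_d2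
  have h1 := (ZeroH2.intervalIntegrable_coeff_mul_mul P.hb P.measurable_muAt P.abs_muAt_le
    (ψ.memLp_d1 P.hb) (χ.memLp_d1 P.hb)).const_mul (4 * r ^ 2)
  have h2 := ZeroH2.intervalIntegrable_coeff_mul_mul P.hb P.measurable_muAt P.abs_muAt_le
    (hh ψ) (hh χ)
  refine (h1.add h2).congr (fun x _ => ?_)
  simp only [viscDensity]
  ring

lemma intervalIntegrable_kinDensity (r : ℝ) (ψ χ : ZeroH2 P.b) :
    IntervalIntegrable (P.kinDensity r ψ χ) volume (-P.b) 1 := by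
  have h1 := (ZeroH2.intervalIntegrable_coeff_mul_mul P.hb P.measurable_rhoAt P.abs_rhoAt_le
    (ψ.memLp_toFun P.hb) (χ.memLp_toFun P.hb)).const_mul (r ^ 2)
  have h2 := ZeroH2.intervalIntegrable_coeff_mul_mul P.hb P.measurable_rhoAt P.abs_rhoAt_le
    (ψ.memLp_d1 P.hb) (χ.memLp_d1 P.hb)
  refine (h1.add h2).congr (fun x _ => ?_)
  simp only [kinDensity]
  ring

lemma constr_eq (r : ℝ) (ψ : ZeroH2 P.b) : P.constr r ψ = 1 / 2 * P.kin r ψ ψ := by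
  unfold constr kin kinDensity
  congr 2
  funext x
  ring

lemma energy_eq (r s : ℝ) (ψ : ZeroH2 P.b) :
    P.energy r s ψ = s * (1 / 2 * P.visc r ψ ψ)
      + 1 / 2 * (r ^ 2 * (P.σp * r ^ 2 + P.g * P.ρp)) * ψ.toFun 1 ^ 2
      - 1 / 2 * P.interfaceCoeff r * ψ.toFun 0 ^ 2 := by
  have : (∫ x in (-P.b)..1,
      s * P.muAt x * (4 * r ^ 2 * ψ.d1 x ^ 2 + (r ^ 2 * ψ.toFun x + ψ.d2 x) ^ 2))
      = s * P.visc r ψ ψ := by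
    unfold visc viscDensity
    rw [← intervalIntegral.integral_const_mul]
    congr 1
    funext x
    ring
  unfold energy interfaceCoeff
  rw [this]
  ring

lemma energy_add_constr (r s : ℝ) (ψ : ZeroH2 P.b) :
    P.energy r s ψ + s ^ 2 * P.constr r ψ
      = 1 / 2 * (P.form r s ψ ψ - P.interfaceCoeff r * ψ.toFun 0 ^ 2) := by
  rw [energy_eq, constr_eq, form]
  ring

lemma viscDensity_self_nonneg (r : ℝ) (ψ : ZeroH2 P.b) (x : ℝ) : 0 ≤ P.viscDensity r ψ ψ x := by
  have := (P.muAt_pos x).le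
  unfold viscDensity
  have : 0 ≤ 4 * r ^ 2 * (ψ.d1 x * ψ.d1 x)
    + (r ^ 2 * ψ.toFun x + ψ.d2 x) * (r ^ 2 * ψ.toFun x + ψ.d2 x) :=
    add_nonneg (mul_nonneg (by positivity) (mul_self_nonneg _)) (mul_self_nonneg _)
  positivity

lemma kinDensity_self_nonneg (r : ℝ) (ψ : ZeroH2 P.b) (x : ℝ) : 0 ≤ P.kinDensity r ψ ψ x := by
  have := (P.rhoAt_pos x).le
  unfold kinDensity
  have : 0 ≤ r ^ 2 * (ψ.toFun x * ψ.toFun x) + ψ.d1 x * ψ.d1 x :=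
    add_nonneg (mul_nonneg (by positivity) (mul_self_nonneg _)) (mul_self_nonneg _)
  positivity

lemma visc_self_nonneg (r : ℝ) (ψ : ZeroH2 P.b) : 0 ≤ P.visc r ψ ψ :=
  intervalIntegral.integral_nonneg P.neg_b_le_one fun x _ => P.viscDensity_self_nonneg r ψ x

lemma kin_self_nonneg (r : ℝ) (ψ : ZeroH2 P.b) : 0 ≤ P.kin r ψ ψ :=
  intervalIntegral.integral_nonneg P.neg_b_le_one fun x _ => P.kinDensity_self_nonneg r ψ x

lemma two_mul_visc_le (r t : ℝ) (ψ χ : ZeroH2 P.b) :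
    2 * t * P.visc r ψ χ - t ^ 2 * P.visc r ψ ψ ≤ P.visc r χ χ := by
  unfold visc
  rw [← intervalIntegral.integral_const_mul, ← intervalIntegral.integral_const_mul,
    ← intervalIntegral.integral_sub ((P.intervalIntegrable_viscDensity r ψ χ).const_mul _)
      ((P.intervalIntegrable_viscDensity r ψ ψ).const_mul _)]
  refine intervalIntegral.integral_mono_on P.neg_b_le_one
    (((P.intervalIntegrable_viscDensity r ψ χ).const_mul _).sub
      ((P.intervalIntegrable_viscDensity r ψ ψ).const_mul _))
    (P.intervalIntegrable_viscDensity r χ χ) fun x _ => ?_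
  have h : 0 ≤ P.muAt x * (4 * r ^ 2 * (χ.d1 x - t * ψ.d1 x) ^ 2
      + ((r ^ 2 * χ.toFun x + χ.d2 x) - t * (r ^ 2 * ψ.toFun x + ψ.d2 x)) ^ 2) :=
    mul_nonneg (P.muAt_pos x).le (by positivity)
  unfold viscDensity
  nlinarith only [h]

lemma two_mul_kin_le (r t : ℝ) (ψ χ : ZeroH2 P.b) :
    2 * t * P.kin r ψ χ - t ^ 2 * P.kin r ψ ψ ≤ P.kin r χ χ := by
  unfold kin
  rw [← intervalIntegral.integral_const_mul, ← intervalIntegral.integral_const_mul,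
    ← intervalIntegral.integral_sub ((P.intervalIntegrable_kinDensity r ψ χ).const_mul _)
      ((P.intervalIntegrable_kinDensity r ψ ψ).const_mul _)]
  refine intervalIntegral.integral_mono_on P.neg_b_le_one
    (((P.intervalIntegrable_kinDensity r ψ χ).const_mul _).sub
      ((P.intervalIntegrable_kinDensity r ψ ψ).const_mul _))
    (P.intervalIntegrable_kinDensity r χ χ) fun x _ => ?_
  have h : 0 ≤ P.rhoAt x * (r ^ 2 * (χ.toFun x - t * ψ.toFun x) ^ 2
      + (χ.d1 x - t * ψ.d1 x) ^ 2) :=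
    mul_nonneg (P.rhoAt_pos x).le (by positivity)
  unfold kinDensity
  nlinarith only [h]

lemma surfaceCoeff_nonneg (r : ℝ) : 0 ≤ r ^ 2 * (P.σp * r ^ 2 + P.g * P.ρp) := by
  have := P.hσp
  have := P.hg
  have := P.hρp
  positivity

/-- The inequality `0 ≤ B(χ - tψ, χ - tψ)`, expanded. -/
lemma two_mul_form_le {r s : ℝ} (hs : 0 ≤ s) (t : ℝ) (ψ χ : ZeroH2 P.b) :
    2 * t * P.form r s ψ χ - t ^ 2 * P.form r s ψ ψ ≤ P.form r s χ χ := by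
  have h1 := mul_le_mul_of_nonneg_left (P.two_mul_visc_le r t ψ χ) hs
  have h2 := mul_le_mul_of_nonneg_left (P.two_mul_kin_le r t ψ χ) (sq_nonneg s)
  have h3 := mul_nonneg (P.surfaceCoeff_nonneg r) (sq_nonneg (χ.toFun 1 - t * ψ.toFun 1))
  unfold form
  nlinarith only [h1, h2, h3]

lemma kin_le_form {r s : ℝ} (hs : 0 ≤ s) (ψ : ZeroH2 P.b) :
    s ^ 2 * P.kin r ψ ψ ≤ P.form r s ψ ψ := by
  have h1 := mul_nonneg hs (P.visc_self_nonneg r ψ)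
  have h3 := mul_nonneg (P.surfaceCoeff_nonneg r) (mul_self_nonneg (ψ.toFun 1))
  unfold form
  linarith

/-- A multiple of `ψ(x)² = ∫ 2ψψ'` is bounded by any integral whose integrand dominates. -/
lemma mul_sq_le_integral (ψ : ZeroH2 P.b) {K x : ℝ} {Φ : ℝ → ℝ} (hx : x ∈ Icc (-P.b) 1)
    (hΦ : IntervalIntegrable Φ volume (-P.b) 1) (h0 : ∀ y, 0 ≤ Φ y)
    (h : ∀ y, y ≤ x → K * (2 * (ψ.toFun y * ψ.d1 y)) ≤ Φ y) :
    K * ψ.toFun x ^ 2 ≤ ∫ y in (-P.b)..1, Φ y := by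
  have hsub : uIcc (-P.b) x ⊆ uIcc (-P.b) 1 :=
    uIcc_subset_uIcc_left (by rwa [uIcc_of_le P.neg_b_le_one])
  have hd := (ψ.intervalIntegrable_d1 P.hb).mono_set hsub
  have hI := ψ.toFun_eq_add P.hb le_rfl hx.2
  have hc : ContinuousOn ψ.toFun (uIcc (-P.b) x) := by
    rw [uIcc_of_le hx.1]
    exact (ψ.continuousOn_toFun P.hb).mono (Icc_subset_Icc_right hx.2)
  have key := integral_mul_add_mul_of_eq_integral hx.1 hd hd hI hI
  rw [ψ.toFun_bot P.hb] at key
  have e : K * ψ.toFun x ^ 2 = ∫ y in (-P.b)..x, K * (2 * (ψ.toFun y * ψ.d1 y)) := by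
    rw [intervalIntegral.integral_const_mul]
    have : (∫ y in (-P.b)..x, 2 * (ψ.toFun y * ψ.d1 y)) = ψ.toFun x * ψ.toFun x := by
      rw [← sub_zero (ψ.toFun x * ψ.toFun x), ← mul_zero (0 : ℝ), ← key]
      congr 1
      funext y
      ring
    rw [this]
    ring
  rw [e]
  calc _ ≤ ∫ y in (-P.b)..x, Φ y :=
        intervalIntegral.integral_mono_on hx.1
          (((hd.continuousOn_mul hc).const_mul 2).const_mul K) (hΦ.mono_set hsub)
          fun y hy => h y hy.2
    _ ≤ _ := intervalIntegral.integral_mono_interval le_rfl hx.1 hx.2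
          (Filter.Eventually.of_forall h0) hΦ

/-- The kinetic form controls the values of the profile. -/
lemma mul_sq_le_kin (r : ℝ) (ψ : ZeroH2 P.b) {x : ℝ} (hx : x ∈ Icc (-P.b) 1) :
    P.ρm * r * ψ.toFun x ^ 2 ≤ P.kin r ψ ψ := by
  refine P.mul_sq_le_integral ψ hx (P.intervalIntegrable_kinDensity r ψ ψ)
    (P.kinDensity_self_nonneg r ψ) fun y _ => ?_
  have h1 : P.ρm * (r * (2 * (ψ.toFun y * ψ.d1 y))) ≤
      P.ρm * (r ^ 2 * (ψ.toFun y * ψ.toFun y) + ψ.d1 y * ψ.d1 y) :=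
    mul_le_mul_of_nonneg_left (by nlinarith only [sq_nonneg (r * ψ.toFun y - ψ.d1 y)]) P.hρm.le
  have h2 : P.ρm * (r ^ 2 * (ψ.toFun y * ψ.toFun y) + ψ.d1 y * ψ.d1 y) ≤
      P.kinDensity r ψ ψ y :=
    mul_le_mul_of_nonneg_right (P.le_rhoAt y)
      (by nlinarith only [sq_nonneg (r * ψ.toFun y), sq_nonneg (ψ.d1 y)])
  linarith

/-- The energy on `{J = 1}` is bounded below by `-energyBound s`, for every frequency. -/
def energyBound (s : ℝ) : ℝ := (P.g * P.rhoJump) ^ 2 / (4 * s * P.μm * P.ρm)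

/-- Viscosity controls `r² ψ'²` and the constraint controls `r² ψ²`, hence together they control
`r² ψ(0)²` uniformly in `r`. -/
lemma neg_energyBound_mul_le {s : ℝ} (hs : 0 < s) (r : ℝ) (ψ : ZeroH2 P.b) :
    -(P.energyBound s * P.constr r ψ) ≤ P.energy r s ψ := by
  have hμ := P.hμm
  have hρ := P.hρm
  have hA : 0 ≤ P.energyBound s := by unfold energyBound; positivity
  have key : (r ^ 2 * (P.g * P.rhoJump)) * ψ.toFun 0 ^ 2 ≤
      ∫ y in (-P.b)..1, (s * P.viscDensity r ψ ψ y + P.energyBound s * P.kinDensity r ψ ψ y) := by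
    refine P.mul_sq_le_integral ψ ⟨by linarith [P.hb], zero_le_one⟩
      (((P.intervalIntegrable_viscDensity r ψ ψ).const_mul s).add
        ((P.intervalIntegrable_kinDensity r ψ ψ).const_mul _))
      (fun y => add_nonneg (mul_nonneg hs.le (P.viscDensity_self_nonneg r ψ y))
        (mul_nonneg hA (P.kinDensity_self_nonneg r ψ y))) fun y hy => ?_
    have hmu : P.muAt y = P.μm := if_neg (not_lt.2 hy)
    have hrho : P.rhoAt y = P.ρm := if_neg (not_lt.2 hy)
    have e : P.energyBound s * P.ρm = (P.g * P.rhoJump) ^ 2 / (4 * s * P.μm) := by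
      unfold energyBound; field_simp
    have h1 : 0 ≤ r ^ 2 * (2 * ψ.d1 y * (s * P.μm) - P.g * P.rhoJump * ψ.toFun y / 2) ^ 2
        / (s * P.μm) := by positivity
    have h2 : r ^ 2 * (2 * ψ.d1 y * (s * P.μm) - P.g * P.rhoJump * ψ.toFun y / 2) ^ 2
        / (s * P.μm) = 4 * s * P.μm * r ^ 2 * ψ.d1 y ^ 2
          - r ^ 2 * (P.g * P.rhoJump) * (2 * (ψ.toFun y * ψ.d1 y))
          + (P.g * P.rhoJump) ^ 2 / (4 * s * P.μm) * (r ^ 2 * ψ.toFun y ^ 2) := by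
      field_simp; ring
    have h3 : 0 ≤ s * P.μm * (r ^ 2 * ψ.toFun y + ψ.d2 y) ^ 2 := by positivity
    have h4 : 0 ≤ P.energyBound s * P.ρm * ψ.d1 y ^ 2 := by positivity
    simp only [viscDensity, kinDensity, hmu, hrho]
    rw [← e] at h2
    nlinarith only [h1, h2, h3, h4]
  rw [intervalIntegral.integral_add ((P.intervalIntegrable_viscDensity r ψ ψ).const_mul s)
        ((P.intervalIntegrable_kinDensity r ψ ψ).const_mul _),
    intervalIntegral.integral_const_mul, intervalIntegral.integral_const_mul] at key
  change _ ≤ s * P.visc r ψ ψ + P.energyBound s * P.kin r ψ ψ at key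
  have h5 := mul_nonneg (P.surfaceCoeff_nonneg r) (sq_nonneg (ψ.toFun 1))
  have h6 : 0 ≤ r ^ 2 * (P.σm * r ^ 2) * ψ.toFun 0 ^ 2 := by have := P.hσm; positivity
  rw [energy_eq, constr_eq, interfaceCoeff]
  nlinarith only [key, h5, h6]

end Params

/-! ### Existence, uniqueness and boundedness of the growth rate -/

namespace Params

variable (P : Params)

lemma kin_smul (r c : ℝ) (ψ : ZeroH2 P.b) :
    P.kin r (ψ.smul c) (ψ.smul c) = c ^ 2 * P.kin r ψ ψ := by
  unfold kin
  rw [← intervalIntegral.integral_const_mul]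
  congr 1
  funext x
  simp only [kinDensity, ZeroH2.smul]
  ring

lemma visc_smul (r c : ℝ) (ψ : ZeroH2 P.b) :
    P.visc r (ψ.smul c) (ψ.smul c) = c ^ 2 * P.visc r ψ ψ := by
  unfold visc
  rw [← intervalIntegral.integral_const_mul]
  congr 1
  funext x
  simp only [viscDensity, ZeroH2.smul]
  ring

lemma constr_smul (r c : ℝ) (ψ : ZeroH2 P.b) :
    P.constr r (ψ.smul c) = c ^ 2 * P.constr r ψ := by
  rw [constr_eq, constr_eq, kin_smul]
  ring

lemma energy_smul (r s c : ℝ) (ψ : ZeroH2 P.b) :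
    P.energy r s (ψ.smul c) = c ^ 2 * P.energy r s ψ := by
  rw [energy_eq, energy_eq, visc_smul]
  simp only [ZeroH2.smul]
  ring

lemma constr_pos_of_ne_zero {r : ℝ} (hr : 0 < r) (ψ : ZeroH2 P.b) {x : ℝ}
    (hx : x ∈ Icc (-P.b) 1) (h : ψ.toFun x ≠ 0) : 0 < P.constr r ψ := by
  have h1 := P.mul_sq_le_kin r ψ hx
  have h2 : 0 < P.ρm * r * ψ.toFun x ^ 2 :=
    mul_pos (mul_pos P.hρm hr) (by positivity)
  rw [constr_eq]
  linarith

lemma zero_mem_Icc : (0 : ℝ) ∈ Icc (-P.b) 1 := ⟨by linarith [P.hb], zero_le_one⟩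

/-- Rescaling to the constraint set `{J = 1}`. -/
lemma constr_normalize {r : ℝ} {ψ : ZeroH2 P.b} (h : 0 < P.constr r ψ) :
    P.constr r (ψ.smul (Real.sqrt (P.constr r ψ))⁻¹) = 1 := by
  rw [constr_smul, inv_pow, Real.sq_sqrt h.le, inv_mul_cancel₀ h.ne']

lemma energy_normalize {r : ℝ} (s : ℝ) {ψ : ZeroH2 P.b} (h : 0 < P.constr r ψ) :
    P.energy r s (ψ.smul (Real.sqrt (P.constr r ψ))⁻¹) = P.energy r s ψ / P.constr r ψ := by
  rw [energy_smul, inv_pow, Real.sq_sqrt h.le, inv_mul_eq_div]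

lemma constr_testFun_pos {r : ℝ} (hr : 0 < r) : 0 < P.constr r (testFun P.hb) := by
  refine P.constr_pos_of_ne_zero hr _ P.zero_mem_Icc ?_
  rw [testFun_zero]
  exact pow_ne_zero _ P.hb.ne'

lemma exists_constr_eq_one {r : ℝ} (hr : 0 < r) : ∃ ψ : ZeroH2 P.b, P.constr r ψ = 1 :=
  ⟨_, P.constr_normalize (P.constr_testFun_pos hr)⟩

lemma bddBelow_energy (r : ℝ) {s : ℝ} (hs : 0 < s) :
    BddBelow (P.energy r s '' {ψ | P.constr r ψ = 1}) := by
  refine ⟨-P.energyBound s, ?_⟩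
  rintro _ ⟨ψ, hψ, rfl⟩
  have := P.neg_energyBound_mul_le hs r ψ
  rwa [show P.constr r ψ = 1 from hψ, mul_one] at this

lemma le_alpha {r s m : ℝ} (hr : 0 < r)
    (h : ∀ ψ : ZeroH2 P.b, P.constr r ψ = 1 → m ≤ P.energy r s ψ) : m ≤ P.alpha r s := by
  refine le_csInf ?_ ?_
  · obtain ⟨ψ, hψ⟩ := P.exists_constr_eq_one hr
    exact ⟨_, ψ, hψ, rfl⟩
  · rintro _ ⟨ψ, hψ, rfl⟩
    exact h ψ hψ

lemma alpha_le {r s : ℝ} (hs : 0 < s) {ψ : ZeroH2 P.b} (h : P.constr r ψ = 1) :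
    P.alpha r s ≤ P.energy r s ψ :=
  csInf_le (P.bddBelow_energy r hs) ⟨ψ, h, rfl⟩

lemma alpha_mul_constr_le {r s : ℝ} (hs : 0 < s) {ψ : ZeroH2 P.b} (h : 0 < P.constr r ψ) :
    P.alpha r s * P.constr r ψ ≤ P.energy r s ψ := by
  have := P.alpha_le hs (P.constr_normalize h)
  rwa [energy_normalize _ _ h, le_div_iff₀ h] at this

lemma neg_energyBound_le_alpha {r s : ℝ} (hr : 0 < r) (hs : 0 < s) :
    -P.energyBound s ≤ P.alpha r s :=
  P.le_alpha hr fun ψ hψ => by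
    have := P.neg_energyBound_mul_le hs r ψ
    rwa [hψ, mul_one] at this

lemma alpha_mono {r s t : ℝ} (hr : 0 < r) (hs : 0 < s) (hst : s ≤ t) :
    P.alpha r s ≤ P.alpha r t :=
  P.le_alpha hr fun ψ hψ => (P.alpha_le hs hψ).trans <| by
    have := mul_le_mul_of_nonneg_right hst (P.visc_self_nonneg r ψ)
    rw [energy_eq, energy_eq]
    linarith

/-- `α(r; ·)` is an infimum of affine functions. -/
lemma concaveOn_alpha {r : ℝ} (hr : 0 < r) : ConcaveOn ℝ (Ioi 0) (P.alpha r) := by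
  refine ⟨convex_Ioi 0, fun s hs t ht a c ha hc hac => P.le_alpha hr fun ψ hψ => ?_⟩
  have h1 := mul_le_mul_of_nonneg_left (P.alpha_le (mem_Ioi.1 hs) hψ) ha
  have h2 := mul_le_mul_of_nonneg_left (P.alpha_le (mem_Ioi.1 ht) hψ) hc
  have e : P.energy r (a • s + c • t) ψ = a * P.energy r s ψ + c * P.energy r t ψ := by
    simp only [energy_eq, smul_eq_mul]
    linear_combination (1 / 2 * (P.interfaceCoeff r * ψ.toFun 0 ^ 2
      - (r ^ 2 * (P.σp * r ^ 2 + P.g * P.ρp)) * ψ.toFun 1 ^ 2)) * hac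
  rw [e, smul_eq_mul, smul_eq_mul]
  linarith

lemma continuousOn_alpha {r : ℝ} (hr : 0 < r) : ContinuousOn (P.alpha r) (Ioi 0) := by
  simpa using (P.concaveOn_alpha hr).continuousOn_interior

/-- The constant `C = (g [ρ])² / (4 μ₋ ρ₋)`; every growth rate satisfies `s³ ≤ C`. -/
def rateConst : ℝ := (P.g * P.rhoJump) ^ 2 / (4 * P.μm * P.ρm)

lemma rateConst_nonneg : 0 ≤ P.rateConst := by
  have := P.hμm
  have := P.hρm
  unfold rateConst
  positivity

lemma energyBound_eq {s : ℝ} (hs : 0 < s) : P.energyBound s = P.rateConst / s := by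
  have := P.hμm.ne'
  have := P.hρm.ne'
  unfold energyBound rateConst
  field_simp

variable {P}

lemma IsSubcritical.interfaceCoeff_pos {r : ℝ} (h : P.IsSubcritical r) :
    0 < P.interfaceCoeff r := by
  refine mul_pos (pow_pos h.1 2) (sub_pos.2 ?_)
  rcases P.hσm.eq_or_lt with h0 | h0
  · rw [← h0, zero_mul]
    exact mul_pos P.hg P.rhoJump_pos
  · have h1 := (Real.lt_sqrt h.1.le).1 (h.2 h0.ne')
    rw [lt_div_iff₀ h0] at h1
    linarith

lemma IsGrowthRate.sq_eq {r s : ℝ} (h : P.IsGrowthRate r s) : s ^ 2 = -P.alpha r s := by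
  have h2 := h.2.2
  calc s ^ 2 = Real.sqrt (-P.alpha r s) ^ 2 := by rw [← h2]
    _ = _ := Real.sq_sqrt (by linarith [h.2.1])

lemma isGrowthRate_of_sq_eq {r s : ℝ} (hs : 0 < s) (h : s ^ 2 = -P.alpha r s) :
    P.IsGrowthRate r s :=
  ⟨hs, by nlinarith, by rw [← h, Real.sqrt_sq hs.le]⟩

lemma IsGrowthRate.le {r s : ℝ} (hr : 0 < r) (h : P.IsGrowthRate r s) :
    s ≤ 1 + P.rateConst := by
  have h1 := P.neg_energyBound_le_alpha hr h.1
  have h2 := h.sq_eq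
  rw [P.energyBound_eq h.1] at h1
  have h3 : s ^ 2 ≤ P.rateConst / s := by linarith
  rw [le_div_iff₀ h.1] at h3
  by_contra hc
  push Not at hc
  have h4 : 1 < s := by linarith [P.rateConst_nonneg]
  have h5 : s * 1 ≤ s * s ^ 2 := mul_le_mul_of_nonneg_left (one_le_pow₀ h4.le) h.1.le
  linarith

lemma IsGrowthRate.unique {r s t : ℝ} (hr : 0 < r) (hs : P.IsGrowthRate r s)
    (ht : P.IsGrowthRate r t) : s = t := by
  have key : ∀ {s t : ℝ}, P.IsGrowthRate r s → P.IsGrowthRate r t → t ≤ s := by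
    intro s t hs ht
    by_contra hc
    push Not at hc
    have h1 := P.alpha_mono hr hs.1 hc.le
    have h2 := hs.sq_eq
    have h3 := ht.sq_eq
    have h4 := pow_lt_pow_left₀ hc hs.1.le two_ne_zero
    linarith
  exact le_antisymm (key ht hs) (key hs ht)

lemma IsSubcritical.exists_isGrowthRate {r : ℝ} (h : P.IsSubcritical r) :
    ∃ s, P.IsGrowthRate r s := by
  have hr := h.1
  have hcont : ContinuousOn (fun s => P.alpha r s + s ^ 2) (Ioi 0) :=
    (P.continuousOn_alpha hr).add (by fun_prop)
  obtain ⟨s₀, hs₀, hneg⟩ : ∃ s₀, 0 < s₀ ∧ P.alpha r s₀ + s₀ ^ 2 < 0 := by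
    set ψ := testFun P.hb with hψ
    have hj : 0 < P.constr r ψ := P.constr_testFun_pos hr
    have hc := h.interfaceCoeff_pos
    have ha := P.visc_self_nonneg r ψ
    have hb2 : 0 < P.b ^ 2 := pow_pos P.hb 2
    set a := 1 / 2 * P.visc r ψ ψ with ha'
    set d := 1 / 2 * P.interfaceCoeff r * (P.b ^ 2) ^ 2 with hd'
    have ha0 : 0 ≤ a := by positivity
    have hd : 0 < d := by positivity
    have hE : ∀ s, P.energy r s ψ = s * a - d := by
      intro s
      rw [energy_eq, hψ, testFun_zero, testFun_one, ← hψ]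
      ring
    set j := P.constr r ψ with hj'
    have haj : 0 < 2 * (a + j) := by positivity
    refine ⟨min 1 (d / (2 * (a + j))), by positivity, ?_⟩
    set s := min 1 (d / (2 * (a + j))) with hs
    have hs0 : 0 < s := by positivity
    have hs1 : s ≤ 1 := min_le_left _ _
    have hs2 : s * (2 * (a + j)) ≤ d := (le_div_iff₀ haj).1 (min_le_right _ _)
    have h1 := P.alpha_mul_constr_le hs0 hj
    rw [hE] at h1
    have h2 : s ^ 2 * j ≤ s * j := mul_le_mul_of_nonneg_right (by nlinarith) hj.le
    have h3 : (P.alpha r s + s ^ 2) * j < 0 := by linarith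
    exact neg_of_mul_neg_left h3 hj.le
  obtain ⟨s₁, hs₁, hpos⟩ : ∃ s₁, 0 < s₁ ∧ 0 < P.alpha r s₁ + s₁ ^ 2 := by
    have hC := P.rateConst_nonneg
    have h1 : 0 < 1 + P.rateConst := by positivity
    refine ⟨1 + P.rateConst, h1, ?_⟩
    have h2 := P.neg_energyBound_le_alpha hr h1
    rw [P.energyBound_eq h1] at h2
    have h3 : P.rateConst / (1 + P.rateConst) < 1 := (div_lt_one h1).2 (by linarith)
    nlinarith
  obtain ⟨s, hs, hs'⟩ := isPreconnected_Ioi.intermediate_value (mem_Ioi.2 hs₀) (mem_Ioi.2 hs₁)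
    hcont ⟨hneg.le, hpos.le⟩
  exact ⟨s, isGrowthRate_of_sq_eq hs (by simp only at hs'; linarith)⟩

lemma bddAbove_growthRates (P : Params) : BddAbove P.growthRates := by
  refine ⟨1 + P.rateConst, ?_⟩
  rintro s ⟨m, hm, hs⟩
  exact hs.le hm.1

/-! ### The minimizer as a Riesz representative -/

/-- Let `w` represent evaluation at the interface with respect to the form `B`. As `α(r; s) = -s²`,
the Cauchy–Schwarz inequality `χ(0)² ≤ w(0) B(χ, χ)` forces `w(0)` to be the reciprocal of the
interface coefficient, so that `E + s² J` is nonnegative and vanishes at `w`. -/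
lemma IsGrowthRate.of_representative {r s : ℝ} (hr : P.IsSubcritical r)
    (hs : P.IsGrowthRate r s) {w : ZeroH2 P.b} (hw : ∀ χ, P.form r s w χ = χ.toFun 0) :
    0 < w.toFun 0 ∧ P.interfaceCoeff r * w.toFun 0 = 1 ∧
      P.IsMinimizer r s (w.smul (Real.sqrt (P.constr r w))⁻¹) := by
  have hs0 := hs.1
  have hα : P.alpha r s = -s ^ 2 := by rw [hs.sq_eq, neg_neg]
  have hc := hr.interfaceCoeff_pos
  set c := P.interfaceCoeff r with hcdef
  have hcs : ∀ (t : ℝ) (χ : ZeroH2 P.b),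
      2 * t * χ.toFun 0 - t ^ 2 * w.toFun 0 ≤ P.form r s χ χ := by
    intro t χ
    have := P.two_mul_form_le hs0.le t w χ (r := r)
    rwa [hw, hw] at this
  have hw0 : 0 < w.toFun 0 := by
    have h1 : 0 ≤ w.toFun 0 := by
      rw [← hw w]
      exact (mul_nonneg (sq_nonneg s) (P.kin_self_nonneg r w)).trans (P.kin_le_form hs0.le w)
    refine h1.lt_of_ne' fun h2 => ?_
    have hb2 : 0 < P.b ^ 2 := pow_pos P.hb 2
    have h3 := hcs ((P.form r s (testFun P.hb) (testFun P.hb) + 1) / (P.b ^ 2)) (testFun P.hb)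
    have h4 : 0 ≤ P.form r s (testFun P.hb) (testFun P.hb) :=
      (mul_nonneg (sq_nonneg s) (P.kin_self_nonneg r _)).trans (P.kin_le_form hs0.le _)
    rw [h2, testFun_zero, mul_zero, sub_zero, mul_assoc, div_mul_cancel₀ _ hb2.ne'] at h3
    linarith
  have hJ : 0 < P.constr r w := P.constr_pos_of_ne_zero hr.1 w P.zero_mem_Icc hw0.ne'
  have hsq : ∀ χ : ZeroH2 P.b, χ.toFun 0 ^ 2 ≤ w.toFun 0 * P.form r s χ χ := by
    intro χ
    have h1 := hcs (χ.toFun 0 / w.toFun 0) χ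
    have h2 : 2 * (χ.toFun 0 / w.toFun 0) * χ.toFun 0 - (χ.toFun 0 / w.toFun 0) ^ 2 * w.toFun 0
        = χ.toFun 0 ^ 2 / w.toFun 0 := by field_simp; ring
    rw [h2, div_le_iff₀ hw0] at h1
    linarith
  have hEw : P.energy r s w + s ^ 2 * P.constr r w
      = 1 / 2 * (w.toFun 0 * (1 - c * w.toFun 0)) := by
    rw [energy_add_constr, hw]
    ring
  have hle : c * w.toFun 0 ≤ 1 := by
    have h1 := P.alpha_mul_constr_le hs0 hJ
    rw [hα] at h1
    by_contra h2
    push Not at h2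
    have h3 : w.toFun 0 * (1 - c * w.toFun 0) < 0 := mul_neg_of_pos_of_neg hw0 (by linarith)
    linarith
  have hlow : ∀ χ : ZeroH2 P.b, (1 - c * w.toFun 0) * (s ^ 2 * P.constr r χ)
      ≤ P.energy r s χ + s ^ 2 * P.constr r χ := by
    intro χ
    have h1 := mul_le_mul_of_nonneg_left (hsq χ) hc.le
    have h2 := mul_le_mul_of_nonneg_left (P.kin_le_form hs0.le χ (r := r))
      (sub_nonneg.2 hle)
    rw [energy_add_constr, constr_eq]
    linarith
  have hge : 1 ≤ c * w.toFun 0 := by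
    by_contra h2
    push Not at h2
    have h3 : (1 - c * w.toFun 0) * s ^ 2 - s ^ 2 ≤ P.alpha r s := by
      refine P.le_alpha hr.1 fun χ hχ => ?_
      have := hlow χ
      rw [hχ] at this
      linarith
    have h4 : 0 < (1 - c * w.toFun 0) * s ^ 2 := mul_pos (by linarith) (by positivity)
    linarith
  have heq : c * w.toFun 0 = 1 := le_antisymm hle hge
  refine ⟨hw0, heq, P.constr_normalize hJ, fun χ hχ => ?_⟩
  rw [energy_normalize _ _ hJ]
  have h1 := hlow χ
  rw [heq, hχ] at h1
  rw [heq] at hEw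
  have h2 : P.energy r s w = -s ^ 2 * P.constr r w := by linarith
  rw [h2, mul_div_cancel_right₀ _ hJ.ne']
  linarith

end Params

/-! ### The profile equation in one layer -/

/-- The `k`-th derivative of `∑ᵢ aᵢ exp (κᵢ x)`. -/
def expSum (κ a : Fin 4 → ℝ) (k : ℕ) (x : ℝ) : ℝ := ∑ i, a i * κ i ^ k * Real.exp (κ i * x)

lemma hasDerivAt_expSum (κ a : Fin 4 → ℝ) (k : ℕ) (x : ℝ) :
    HasDerivAt (expSum κ a k) (expSum κ a (k + 1) x) x := by
  unfold expSum
  refine HasDerivAt.fun_sum fun i _ => ?_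
  have h1 : HasDerivAt (fun x : ℝ => κ i * x) (κ i) x := by
    simpa using (hasDerivAt_id x).const_mul (κ i)
  have h := h1.exp.const_mul (a i * κ i ^ k)
  exact h.congr_deriv (by ring)

lemma expSum_add (κ a a' : Fin 4 → ℝ) (k : ℕ) (x : ℝ) :
    expSum κ (a + a') k x = expSum κ a k x + expSum κ a' k x := by
  simp only [expSum, Pi.add_apply, add_mul, Finset.sum_add_distrib]

lemma expSum_smul (κ a : Fin 4 → ℝ) (c : ℝ) (k : ℕ) (x : ℝ) :
    expSum κ (c • a) k x = c * expSum κ a k x := by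
  simp only [expSum, Pi.smul_apply, smul_eq_mul, Finset.mul_sum, mul_assoc]

lemma eq_zero_of_expSum_eqOn {κ a : Fin 4 → ℝ} (hκ : Function.Injective κ) {u v : ℝ} (huv : u < v)
    (h : ∀ x ∈ Ioo u v, expSum κ a 0 x = 0) : a = 0 := by
  have hk : ∀ k, ∀ x ∈ Ioo u v, expSum κ a k x = 0 := by
    intro k
    induction k with
    | zero => exact h
    | succ k ih =>
      intro x hx
      have h1 : HasDerivAt (expSum κ a k) 0 x := by
        refine (hasDerivAt_const x (0 : ℝ)).congr_of_eventuallyEq ?_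
        filter_upwards [Ioo_mem_nhds hx.1 hx.2] with y hy using ih y hy
      exact (hasDerivAt_expSum κ a k x).unique h1
  obtain ⟨x, hx⟩ := nonempty_Ioo.2 huv
  have h0 : (fun i => a i * Real.exp (κ i * x)) = 0 := by
    refine Matrix.eq_zero_of_forall_pow_sum_mul_pow_eq_zero hκ fun k => ?_
    rw [← hk k x hx, expSum]
    exact Finset.sum_congr rfl fun i _ => by ring
  funext i
  have := congrFun h0 i
  simpa [Real.exp_ne_zero] using this

namespace Params

variable (P : Params)

lemma mu_pos (j : Side) : 0 < P.mu j := by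
  cases j
  exacts [P.hμp, P.hμm]

lemma rho_pos (j : Side) : 0 < P.rho j := by
  cases j
  exacts [P.hρp, P.hρm]

/-- The characteristic exponents `±r`, `±√(r² + sρ/μ)` of the profile equation in a layer. -/
def charExp (r s : ℝ) (j : Side) : Fin 4 → ℝ :=
  ![r, -r, Real.sqrt (r ^ 2 + s * P.rho j / P.mu j), -Real.sqrt (r ^ 2 + s * P.rho j / P.mu j)]

lemma charExp_injective {r s : ℝ} (hr : 0 < r) (hs : 0 < s) (j : Side) :
    Function.Injective (P.charExp r s j) := by
  have h1 : r < Real.sqrt (r ^ 2 + s * P.rho j / P.mu j) := by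
    have := P.mu_pos j
    have := P.rho_pos j
    rw [Real.lt_sqrt hr.le]
    exact lt_add_of_pos_right _ (by positivity)
  set q := Real.sqrt (r ^ 2 + s * P.rho j / P.mu j) with hq
  intro i k hik
  fin_cases i <;> fin_cases k <;> first
    | rfl
    | (exfalso
       simp [charExp, ← hq] at hik
       linarith)

/-- The solution of the profile equation in the layer `j` with coefficients `a`, and its
derivatives of all orders. -/
def layer (r s : ℝ) (j : Side) (a : Fin 4 → ℝ) : ℕ → ℝ → ℝ := expSum (P.charExp r s j) a

lemma hasDerivAt_layer (r s : ℝ) (j : Side) (a : Fin 4 → ℝ) (k : ℕ) (x : ℝ) :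
    HasDerivAt (P.layer r s j a k) (P.layer r s j a (k + 1) x) x :=
  hasDerivAt_expSum _ _ _ _

lemma layer_ode {r s : ℝ} (hs : 0 < s) (j : Side) (a : Fin 4 → ℝ) (x : ℝ) :
    P.mu j * (P.layer r s j a 4 x - 2 * r ^ 2 * P.layer r s j a 2 x
      + r ^ 4 * P.layer r s j a 0 x)
      = s * P.rho j * (P.layer r s j a 2 x - r ^ 2 * P.layer r s j a 0 x) := by
  have hm := P.mu_pos j
  have hp := P.rho_pos j
  have hq : Real.sqrt (r ^ 2 + s * P.rho j / P.mu j) ^ 2 = r ^ 2 + s * P.rho j / P.mu j :=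
    Real.sq_sqrt (by positivity)
  have hq' : P.mu j * (Real.sqrt (r ^ 2 + s * P.rho j / P.mu j) ^ 2 - r ^ 2) = s * P.rho j := by
    rw [hq]; field_simp; ring
  simp only [layer, expSum, Fin.sum_univ_four, charExp, Matrix.cons_val]
  set q := Real.sqrt (r ^ 2 + s * P.rho j / P.mu j)
  linear_combination ((q ^ 2 - r ^ 2) * (a 2 * Real.exp (q * x) + a 3 * Real.exp (-q * x))) * hq'

/-- `μ (ψ'' + r² ψ)`, proportional to the tangential stress of a mode. -/
def tangFlux (r s : ℝ) (j : Side) (a : Fin 4 → ℝ) (x : ℝ) : ℝ :=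
  P.mu j * (r ^ 2 * P.layer r s j a 0 x + P.layer r s j a 2 x)

/-- `s μ (3 r² ψ' - ψ''') + s² ρ ψ'`, proportional to the normal stress of a mode. -/
def normFlux (r s : ℝ) (j : Side) (a : Fin 4 → ℝ) (x : ℝ) : ℝ :=
  s * P.mu j * (3 * r ^ 2 * P.layer r s j a 1 x - P.layer r s j a 3 x)
    + s ^ 2 * P.rho j * P.layer r s j a 1 x

/-- The weak form of the profile equation in one layer. -/
lemma integral_layer {r s : ℝ} (hs : 0 < s) (j : Side) (a : Fin 4 → ℝ) (χ : ZeroH2 P.b) {u v : ℝ}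
    (hu : -P.b ≤ u) (huv : u ≤ v) (hv : v ≤ 1) :
    ∫ x in u..v, (s * (P.mu j * (4 * r ^ 2 * (P.layer r s j a 1 x * χ.d1 x)
        + (r ^ 2 * P.layer r s j a 0 x + P.layer r s j a 2 x) * (r ^ 2 * χ.toFun x + χ.d2 x)))
      + s ^ 2 * (P.rho j * (r ^ 2 * (P.layer r s j a 0 x * χ.toFun x)
        + P.layer r s j a 1 x * χ.d1 x)))
    = (s * P.tangFlux r s j a v * χ.d1 v + P.normFlux r s j a v * χ.toFun v)
      - (s * P.tangFlux r s j a u * χ.d1 u + P.normFlux r s j a u * χ.toFun u) := by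
  have hd := P.hasDerivAt_layer r s j a
  have hc : ∀ k, Continuous (P.layer r s j a k) := fun k =>
    continuous_iff_continuousAt.2 fun x => (hd k x).continuousAt
  have hsub : uIcc u v ⊆ uIcc (-P.b) 1 := by
    rw [uIcc_of_le huv, uIcc_of_le P.neg_b_le_one]
    exact Icc_subset_Icc hu hv
  have hχ1 := (χ.intervalIntegrable_d1 P.hb).mono_set hsub
  have hχ2 := (χ.intervalIntegrable_d2 P.hb).mono_set hsub
  have hχc1 : ContinuousOn χ.d1 (uIcc u v) := by
    rw [uIcc_of_le huv]
    exact (χ.continuousOn_d1 P.hb).mono (Icc_subset_Icc hu hv)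
  have hχc0 : ContinuousOn χ.toFun (uIcc u v) := by
    rw [uIcc_of_le huv]
    exact (χ.continuousOn_toFun P.hb).mono (Icc_subset_Icc hu hv)
  have hprim : ∀ {F f : ℝ → ℝ}, (∀ x, HasDerivAt F (f x) x) → Continuous f →
      ∀ x ∈ Icc u v, F x = F u + ∫ t in u..x, f t := by
    intro F f hF hf x hx
    rw [intervalIntegral.integral_eq_sub_of_hasDerivAt (fun y _ => hF y) (hf.intervalIntegrable _ _)]
    ring
  set M : ℝ → ℝ := fun x => s * P.tangFlux r s j a x with hM
  set M' : ℝ → ℝ := fun x =>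
    s * (P.mu j * (r ^ 2 * P.layer r s j a 1 x + P.layer r s j a 3 x)) with hM'
  set N : ℝ → ℝ := P.normFlux r s j a with hN
  set N' : ℝ → ℝ := fun x => s * P.mu j * (3 * r ^ 2 * P.layer r s j a 2 x - P.layer r s j a 4 x)
    + s ^ 2 * P.rho j * P.layer r s j a 2 x with hN'
  have hMd : ∀ x, HasDerivAt M (M' x) x := fun x =>
    ((((hd 0 x).const_mul (r ^ 2)).add (hd 2 x)).const_mul (P.mu j)).const_mul s
  have hNd : ∀ x, HasDerivAt N (N' x) x := fun x =>
    ((((hd 1 x).const_mul (3 * r ^ 2)).sub (hd 3 x)).const_mul (s * P.mu j)).add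
      ((hd 1 x).const_mul (s ^ 2 * P.rho j))
  have hM'c : Continuous M' := by
    have := hc 1; have := hc 3
    fun_prop
  have hN'c : Continuous N' := by
    have := hc 2; have := hc 4
    fun_prop
  have hMc : Continuous M := continuous_iff_continuousAt.2 fun x => (hMd x).continuousAt
  have hNc : Continuous N := continuous_iff_continuousAt.2 fun x => (hNd x).continuousAt
  have i1 := integral_mul_add_mul_of_eq_integral huv (hM'c.intervalIntegrable _ _) hχ2
    (hprim hMd hM'c) (χ.d1_eq_add P.hb hu hv)
  have i2 := integral_mul_add_mul_of_eq_integral huv (hN'c.intervalIntegrable _ _) hχ1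
    (hprim hNd hN'c) (χ.toFun_eq_add P.hb hu hv)
  have j1 : IntervalIntegrable (fun x => M' x * χ.d1 x + M x * χ.d2 x) volume u v :=
    (hχ1.continuousOn_mul hM'c.continuousOn).add (hχ2.continuousOn_mul hMc.continuousOn)
  have j2 : IntervalIntegrable (fun x => N' x * χ.toFun x + N x * χ.d1 x) volume u v :=
    ((hN'c.continuousOn.mul hχc0).intervalIntegrable).add
      (hχ1.continuousOn_mul hNc.continuousOn)
  have e : (s * P.tangFlux r s j a v * χ.d1 v + P.normFlux r s j a v * χ.toFun v)
      - (s * P.tangFlux r s j a u * χ.d1 u + P.normFlux r s j a u * χ.toFun u)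
      = (M v * χ.d1 v - M u * χ.d1 u) + (N v * χ.toFun v - N u * χ.toFun u) := by
    simp only [hM, hN]
    ring
  rw [e, ← i1, ← i2, ← intervalIntegral.integral_add j1 j2]
  congr 1
  funext x
  simp only [hM, hM', hN, hN', tangFlux, normFlux]
  linear_combination (s * χ.toFun x) * P.layer_ode (r := r) hs j a x

/-! ### The two-layer boundary value problem -/

/-- The boundary and transmission data of a pair of layer solutions, in the order: the two
conditions at the bottom, the jumps of the value and of the first derivative at the interface, the
two natural conditions at the free surface, the jumps of the two fluxes at the interface. -/
def bvpMap (r s : ℝ) : (Fin 4 → ℝ) × (Fin 4 → ℝ) →ₗ[ℝ] (Fin 8 → ℝ) where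
  toFun a := ![P.layer r s .lower a.2 0 (-P.b), P.layer r s .lower a.2 1 (-P.b),
    P.layer r s .upper a.1 0 0 - P.layer r s .lower a.2 0 0,
    P.layer r s .upper a.1 1 0 - P.layer r s .lower a.2 1 0,
    P.tangFlux r s .upper a.1 1,
    P.normFlux r s .upper a.1 1
      + r ^ 2 * (P.σp * r ^ 2 + P.g * P.ρp) * P.layer r s .upper a.1 0 1,
    P.tangFlux r s .lower a.2 0 - P.tangFlux r s .upper a.1 0,
    P.normFlux r s .lower a.2 0 - P.normFlux r s .upper a.1 0]
  map_add' a a' := by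
    funext i
    fin_cases i <;> simp [tangFlux, normFlux, layer, expSum_add] <;> ring
  map_smul' c a := by
    funext i
    fin_cases i <;> simp [tangFlux, normFlux, layer, expSum_smul] <;> ring

/-- The coefficients `a` (upper and lower layer) solve the boundary value problem in which the only
inhomogeneous condition is the jump `d` of the normal flux at the interface. -/
structure IsBvpSolution (r s d : ℝ) (a : (Fin 4 → ℝ) × (Fin 4 → ℝ)) : Prop where
  bot₀ : P.layer r s .lower a.2 0 (-P.b) = 0
  bot₁ : P.layer r s .lower a.2 1 (-P.b) = 0
  jump₀ : P.layer r s .upper a.1 0 0 = P.layer r s .lower a.2 0 0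
  jump₁ : P.layer r s .upper a.1 1 0 = P.layer r s .lower a.2 1 0
  tang_top : P.tangFlux r s .upper a.1 1 = 0
  norm_top : P.normFlux r s .upper a.1 1
      + r ^ 2 * (P.σp * r ^ 2 + P.g * P.ρp) * P.layer r s .upper a.1 0 1 = 0
  tang_jump : P.tangFlux r s .lower a.2 0 = P.tangFlux r s .upper a.1 0
  norm_jump : P.normFlux r s .lower a.2 0 - P.normFlux r s .upper a.1 0 = d

lemma isBvpSolution_of_bvpMap_eq {r s d : ℝ} {a : (Fin 4 → ℝ) × (Fin 4 → ℝ)}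
    (h : P.bvpMap r s a = ![0, 0, 0, 0, 0, 0, 0, d]) : P.IsBvpSolution r s d a :=
  ⟨congrFun h 0, congrFun h 1, sub_eq_zero.1 (congrFun h 2), sub_eq_zero.1 (congrFun h 3),
    congrFun h 4, congrFun h 5, sub_eq_zero.1 (congrFun h 6), congrFun h 7⟩

variable {P}

/-- The profile assembled from the two layers. -/
def IsBvpSolution.profile {r s d : ℝ} {a : (Fin 4 → ℝ) × (Fin 4 → ℝ)}
    (h : P.IsBvpSolution r s d a) : ZeroH2 P.b :=
  ZeroH2.glue P.hb (P.layer r s .upper a.1) (P.layer r s .lower a.2)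
    (P.hasDerivAt_layer r s _ _) (P.hasDerivAt_layer r s _ _) h.jump₀ h.jump₁ h.bot₀ h.bot₁

lemma IsBvpSolution.form_profile {r s d : ℝ} (hs : 0 < s) {a : (Fin 4 → ℝ) × (Fin 4 → ℝ)}
    (h : P.IsBvpSolution r s d a) (χ : ZeroH2 P.b) :
    P.form r s h.profile χ = d * χ.toFun 0 := by
  have hb := P.hb
  have hV := (P.intervalIntegrable_viscDensity r h.profile χ).const_mul s
  have hK := (P.intervalIntegrable_kinDensity r h.profile χ).const_mul (s ^ 2)
  have hI := hV.add hK
  have h0 : (0 : ℝ) ∈ uIcc (-P.b) 1 := by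
    rw [uIcc_of_le P.neg_b_le_one]; exact P.zero_mem_Icc
  have hlow := P.integral_layer hs .lower a.2 χ le_rfl (by linarith) zero_le_one (v := 0) (r := r)
  have hup := P.integral_layer hs .upper a.1 χ (u := 0) (v := 1) (by linarith) zero_le_one le_rfl
    (r := r)
  have e1 : s * P.visc r h.profile χ + s ^ 2 * P.kin r h.profile χ
      = (∫ x in (-P.b)..0, (s * P.viscDensity r h.profile χ x
          + s ^ 2 * P.kinDensity r h.profile χ x))
        + ∫ x in (0)..1, (s * P.viscDensity r h.profile χ x
          + s ^ 2 * P.kinDensity r h.profile χ x) := by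
    rw [intervalIntegral.integral_add_adjacent_intervals
      (hI.mono_set (uIcc_subset_uIcc_left h0)) (hI.mono_set (uIcc_subset_uIcc_right h0)),
      intervalIntegral.integral_add hV hK, intervalIntegral.integral_const_mul,
      intervalIntegral.integral_const_mul]
    rfl
  rw [form, e1]
  have e2 := Eq.trans (a := ∫ x in (-P.b)..0, (s * P.viscDensity r h.profile χ x
          + s ^ 2 * P.kinDensity r h.profile χ x)) (by
    refine intervalIntegral.integral_congr_ae (Filter.Eventually.of_forall fun x hx => ?_)
    rw [uIoc_of_le (by linarith)] at hx
    simp [viscDensity, kinDensity, muAt, rhoAt, profile, ZeroH2.glue, not_lt.2 hx.2, mu, rho]) hlow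
  have e3 := Eq.trans (a := ∫ x in (0)..1, (s * P.viscDensity r h.profile χ x
          + s ^ 2 * P.kinDensity r h.profile χ x)) (by
    refine intervalIntegral.integral_congr_ae (Filter.Eventually.of_forall fun x hx => ?_)
    rw [uIoc_of_le zero_le_one] at hx
    simp [viscDensity, kinDensity, muAt, rhoAt, profile, ZeroH2.glue, hx.1, mu, rho]) hup
  rw [e2, e3, χ.toFun_bot P.hb, χ.d1_bot P.hb, h.tang_top, h.tang_jump]
  have e4 : h.profile.toFun 1 = P.layer r s .upper a.1 0 1 := by simp [profile, ZeroH2.glue]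
  rw [e4]
  linear_combination χ.toFun 1 * h.norm_top + χ.toFun 0 * h.norm_jump

/-- The boundary value problem has only the trivial homogeneous solution, since such a solution `w`
satisfies `B(w, w) = 0`; hence it can be solved for arbitrary data. -/
lemma exists_isBvpSolution (P : Params) {r s : ℝ} (hr : 0 < r) (hs : 0 < s) (d : ℝ) :
    ∃ a, P.IsBvpSolution r s d a := by
  have hinj : Function.Injective (P.bvpMap r s) := by
    rw [← LinearMap.ker_eq_bot, LinearMap.ker_eq_bot']
    intro a ha
    have h : P.IsBvpSolution r s 0 a := P.isBvpSolution_of_bvpMap_eq <| by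
      rw [ha]
      funext i
      fin_cases i <;> rfl
    have h1 := h.form_profile hs h.profile
    rw [zero_mul] at h1
    have h2 : P.kin r h.profile h.profile = 0 := by
      have h3 := P.kin_le_form hs.le h.profile (r := r)
      have h4 := P.kin_self_nonneg r h.profile
      rw [h1] at h3
      have h5 : 0 < s ^ 2 := by positivity
      nlinarith
    have h3 : ∀ x ∈ Icc (-P.b) 1, h.profile.toFun x = 0 := by
      intro x hx
      by_contra hne
      have h6 := P.constr_pos_of_ne_zero hr _ hx hne
      rw [constr_eq, h2] at h6
      linarith
    have hb := P.hb
    have hup : a.1 = 0 := by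
      refine eq_zero_of_expSum_eqOn (P.charExp_injective hr hs .upper) zero_lt_one fun x hx => ?_
      have := h3 x ⟨by linarith [hx.1], hx.2.le⟩
      simpa [IsBvpSolution.profile, ZeroH2.glue, hx.1, layer] using this
    have hlow : a.2 = 0 := by
      refine eq_zero_of_expSum_eqOn (P.charExp_injective hr hs .lower)
        (show -P.b < 0 by linarith) fun x hx => ?_
      have := h3 x ⟨hx.1.le, by linarith [hx.2]⟩
      simpa [IsBvpSolution.profile, ZeroH2.glue, not_lt.2 hx.2.le, layer] using this
    exact Prod.ext hup hlow
  have hsurj := (LinearMap.injective_iff_surjective_of_finrank_eq_finrank (by simp)).1 hinj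
  obtain ⟨a, ha⟩ := hsurj ![0, 0, 0, 0, 0, 0, 0, d]
  exact ⟨a, P.isBvpSolution_of_bvpMap_eq ha⟩

end Params

/-! ### Partial derivatives within a set -/

section PartialDerivatives

variable {n : ℕ} {F G : Type*} [NormedAddCommGroup F] [NormedSpace ℝ F]
  [NormedAddCommGroup G] [NormedSpace ℝ G] {S D : Set (Fin n → ℝ)} {f g : (Fin n → ℝ) → F}

lemma pd_congr (i : Fin n) (h : EqOn f g S) : EqOn (pd S i f) (pd S i g) S := by
  intro x hx
  simp only [pd, fderivWithin_congr h (h hx)]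

lemma contDiffOn_pd (hS : UniqueDiffOn ℝ S) (i : Fin n) (hf : ContDiffOn ℝ ∞ f S) :
    ContDiffOn ℝ ∞ (pd S i f) S := by
  have h : ContDiffOn ℝ ∞ (fderivWithin ℝ f S) S := hf.fderivWithin hS (by simp)
  exact h.clm_apply contDiffOn_const

lemma pd_clm_comp (hS : UniqueDiffOn ℝ S) (i : Fin n) (L : F →L[ℝ] G)
    (hf : ContDiffOn ℝ ∞ f S) :
    EqOn (pd S i fun x => L (f x)) (fun x => L (pd S i f x)) S := by
  intro x hx
  have hd : DifferentiableWithinAt ℝ f S x := (hf x hx).differentiableWithinAt (by simp)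
  have h := L.hasFDerivAt.comp_hasFDerivWithinAt x hd.hasFDerivWithinAt
  simp only [pd]
  rw [show (fun x => L (f x)) = L ∘ f from rfl, h.fderivWithin (hS x hx)]
  rfl

lemma contDiffOn_iterate_pd (hS : UniqueDiffOn ℝ S) (i : Fin n) (hf : ContDiffOn ℝ ∞ f S) (k : ℕ) :
    ContDiffOn ℝ ∞ ((pd S i)^[k] f) S := by
  induction k with
  | zero => exact hf
  | succ k ih =>
    rw [Function.iterate_succ_apply']
    exact contDiffOn_pd hS i ih

lemma iterate_pd_clm_comp (hS : UniqueDiffOn ℝ S) (i : Fin n) (L : F →L[ℝ] G)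
    (hf : ContDiffOn ℝ ∞ f S) {h : (Fin n → ℝ) → G} (hh : EqOn h (fun x => L (f x)) S) (k : ℕ) :
    EqOn ((pd S i)^[k] h) (fun x => L ((pd S i)^[k] f x)) S := by
  induction k with
  | zero => exact hh
  | succ k ih =>
    simp only [Function.iterate_succ_apply']
    exact (pd_congr i ih).trans (pd_clm_comp hS i L (contDiffOn_iterate_pd hS i hf k))

lemma contDiffOn_mixedPd (hS : UniqueDiffOn ℝ S) (α : Fin n → ℕ) (hf : ContDiffOn ℝ ∞ f S) :
    ContDiffOn ℝ ∞ (mixedPd S α f) S := by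
  unfold mixedPd
  induction List.finRange n with
  | nil => exact hf
  | cons i l ih => exact contDiffOn_iterate_pd hS i ih _

lemma mixedPd_clm_comp (hS : UniqueDiffOn ℝ S) (α : Fin n → ℕ) (L : F →L[ℝ] G)
    (hf : ContDiffOn ℝ ∞ f S) :
    EqOn (mixedPd S α fun x => L (f x)) (fun x => L (mixedPd S α f x)) S := by
  have key : ∀ l : List (Fin n),
      ContDiffOn ℝ ∞ (l.foldr (fun i h => (pd S i)^[α i] h) f) S ∧
      EqOn (l.foldr (fun i h => (pd S i)^[α i] h) fun x => L (f x))
        (fun x => L (l.foldr (fun i h => (pd S i)^[α i] h) f x)) S := by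
    intro l
    induction l with
    | nil => exact ⟨hf, fun _ _ => rfl⟩
    | cons i l ih =>
      exact ⟨contDiffOn_iterate_pd hS i ih.1 _, iterate_pd_clm_comp hS i L ih.1 ih.2 _⟩
  exact (key _).2

/-! ### Sobolev norms of functions that are smooth up to the boundary -/

lemma memHk_of_contDiffOn (hS : UniqueDiffOn ℝ S) {K : Set (Fin n → ℝ)} (hD : MeasurableSet D)
    (hDK : D ⊆ K) (hK : IsCompact K) (hKS : K ⊆ S) (hf : ContDiffOn ℝ ∞ f S) (k : ℕ) :
    MemHk S D k f := by
  intro α _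
  have hc := (contDiffOn_mixedPd hS α hf).continuousOn.mono hKS
  obtain ⟨C, hC⟩ := hK.exists_bound_of_continuousOn hc
  have hfin : IsFiniteMeasure (volume.restrict D) :=
    ⟨by rw [Measure.restrict_apply_univ]; exact (measure_mono hDK).trans_lt hK.measure_lt_top⟩
  refine MemLp.of_bound ((hc.mono hDK).aestronglyMeasurable hD) C ?_
  filter_upwards [ae_restrict_mem hD] with x hx using hC x (hDK hx)

lemma hkNormSq_nonneg (S D : Set (Fin n → ℝ)) (k : ℕ) (f : (Fin n → ℝ) → F) :
    0 ≤ hkNormSq S D k f :=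
  Finset.sum_nonneg fun _ _ => integral_nonneg fun _ => by positivity

lemma hkNormSq_smul (hS : UniqueDiffOn ℝ S) (hD : MeasurableSet D) (hDS : D ⊆ S)
    (hf : ContDiffOn ℝ ∞ f S) (c : ℝ) (k : ℕ) :
    hkNormSq S D k (fun x => c • f x) = c ^ 2 * hkNormSq S D k f := by
  unfold hkNormSq
  rw [Finset.mul_sum]
  refine Finset.sum_congr rfl fun α _ => ?_
  rw [← integral_const_mul]
  refine setIntegral_congr_fun hD fun x hx => ?_
  have h := mixedPd_clm_comp hS α (c • ContinuousLinearMap.id ℝ F) hf (hDS hx)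
  simp only [smul_apply, ContinuousLinearMap.id_apply] at h
  simp only [h, norm_smul, mul_pow, Real.norm_eq_abs, sq_abs]

lemma hkNormSq_pos (hS : UniqueDiffOn ℝ S) {K : Set (Fin n → ℝ)} (hD : IsOpen D)
    (hDK : D ⊆ K) (hK : IsCompact K) (hKS : K ⊆ S) (hf : ContDiffOn ℝ ∞ f S) {x : Fin n → ℝ}
    (hx : x ∈ D) (hfx : f x ≠ 0) (k : ℕ) : 0 < hkNormSq S D k f := by
  have h0 : (0 : Fin n → ℕ) ∈ multiIndices n k := by simp [multiIndices]
  have hmix : mixedPd S 0 f = f := by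
    unfold mixedPd
    induction List.finRange n with
    | nil => rfl
    | cons i l ih => exact ih
  refine lt_of_lt_of_le ?_ (Finset.single_le_sum
    (f := fun α => ∫ x in D, ‖mixedPd S α f x‖ ^ 2)
    (fun _ _ => integral_nonneg fun _ => by positivity) h0)
  have hmem := memHk_of_contDiffOn hS hD.measurableSet hDK hK hKS hf k 0 h0
  rw [hmix] at hmem
  simp only [hmix]
  have hint : IntegrableOn (fun x => ‖f x‖ ^ 2) D := hmem.integrable_norm_pow two_ne_zero
  rw [setIntegral_pos_iff_support_of_nonneg_ae
    (Filter.Eventually.of_forall fun _ => by positivity) hint]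
  have hopen : IsOpen (D ∩ f ⁻¹' {0}ᶜ) :=
    ((hf.continuousOn.mono (hDK.trans hKS)).isOpen_inter_preimage hD isOpen_compl_singleton)
  refine (hopen.measure_pos volume ⟨x, hx, hfx⟩).trans_le (measure_mono ?_)
  rintro y ⟨hy, hfy⟩
  refine ⟨?_, hy⟩
  have : f y ≠ 0 := hfy
  simpa using this

end PartialDerivatives

namespace Params

variable (P : Params)

/-! ### The fluid domains -/

lemma bot_lt_top (s : Side) : P.bot s < top s := by
  cases s
  · exact zero_lt_one
  · exact neg_lt_zero.2 P.hb

lemma isOpen_openSlab (s : Side) : IsOpen (P.openSlab s) :=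
  isOpen_Ioo.preimage (continuous_apply 2)

lemma openSlab_subset (s : Side) : P.openSlab s ⊆ P.slab s := fun _ hx => Ioo_subset_Icc_self hx

lemma convex_slab (s : Side) : Convex ℝ (P.slab s) :=
  (convex_Icc (P.bot s) (top s)).linear_preimage (LinearMap.proj (R := ℝ) (φ := fun _ : Fin 3 => ℝ) 2)

lemma uniqueDiffOn_slab (s : Side) : UniqueDiffOn ℝ (P.slab s) := by
  refine uniqueDiffOn_convex (P.convex_slab s) ?_
  obtain ⟨z, hz⟩ := nonempty_Ioo.2 (P.bot_lt_top s)
  exact ⟨fun _ => z, interior_maximal (P.openSlab_subset s) (P.isOpen_openSlab s) hz⟩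

lemma isOpen_torusCell : IsOpen P.torusCell :=
  (isOpen_Ioo.preimage (continuous_apply 0)).inter (isOpen_Ioo.preimage (continuous_apply 1))

lemma torusCell_subset :
    P.torusCell ⊆ Icc ![0, 0] ![2 * Real.pi * P.L₁, 2 * Real.pi * P.L₂] := by
  rintro y ⟨h0, h1⟩
  refine ⟨fun i => ?_, fun i => ?_⟩ <;> fin_cases i
  exacts [h0.1.le, h1.1.le, h0.2.le, h1.2.le]

lemma isOpen_cell (s : Side) : IsOpen (P.cell s) := by
  refine IsOpen.inter ?_ (P.isOpen_openSlab s)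
  refine P.isOpen_torusCell.preimage (continuous_pi fun i => ?_)
  fin_cases i
  · exact continuous_apply 0
  · exact continuous_apply 1

lemma cell_subset (s : Side) : P.cell s ⊆
    Icc ![0, 0, P.bot s] ![2 * Real.pi * P.L₁, 2 * Real.pi * P.L₂, top s] := by
  rintro x ⟨⟨h0, h1⟩, h2⟩
  refine ⟨fun i => ?_, fun i => ?_⟩ <;> fin_cases i
  exacts [h0.1.le, h1.1.le, h2.1.le, h0.2.le, h1.2.le, h2.2.le]

lemma box_subset_slab (s : Side) :
    Icc ![0, 0, P.bot s] ![2 * Real.pi * P.L₁, 2 * Real.pi * P.L₂, top s] ⊆ P.slab s :=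
  fun _ hx => ⟨hx.1 2, hx.2 2⟩

lemma at_mem_slab {s : Side} {h : ℝ} (hh : h ∈ Icc (P.bot s) (top s)) (y : Fin 2 → ℝ) :
    at_ y h ∈ P.slab s := hh

/-! ### Transformations of solutions -/

section Solutions

variable {P} {F G : Type*} [NormedAddCommGroup F] [NormedSpace ℝ F]
  [NormedAddCommGroup G] [NormedSpace ℝ G]
  {u : Side → ℝ → (Fin 3 → ℝ) → Fin 3 → F} {p : Side → ℝ → (Fin 3 → ℝ) → F}
  {η : Side → ℝ → (Fin 2 → ℝ) → F}

lemma IsSolution.contDiffOn_u (h : P.IsSolution u p η) (s : Side) (t : ℝ) (i : Fin 3) :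
    ContDiffOn ℝ ∞ (fun x => u s t x i) (P.slab s) :=
  (h.smooth_u s i).comp (f := fun x => (t, x)) (contDiff_const.prodMk contDiff_id).contDiffOn
    fun _ hx => ⟨mem_univ _, hx⟩

lemma IsSolution.contDiffOn_p (h : P.IsSolution u p η) (s : Side) (t : ℝ) :
    ContDiffOn ℝ ∞ (p s t) (P.slab s) :=
  (h.smooth_p s).comp (f := fun x => (t, x)) (contDiff_const.prodMk contDiff_id).contDiffOn
    fun _ hx => ⟨mem_univ _, hx⟩

lemma IsSolution.contDiffOn_η (h : P.IsSolution u p η) (s : Side) (t : ℝ) :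
    ContDiffOn ℝ ∞ (η s t) univ :=
  ((h.smooth_η s).comp (f := fun y => (t, y)) (contDiff_const.prodMk contDiff_id)).contDiffOn

lemma IsSolution.differentiableAt_u (h : P.IsSolution u p η) (s : Side) (t : ℝ) {x : Fin 3 → ℝ}
    (hx : x ∈ P.slab s) (i : Fin 3) : DifferentiableAt ℝ (fun τ => u s τ x i) t := by
  have h1 : ContDiffOn ℝ ∞ (fun τ => u s τ x i) univ :=
    (h.smooth_u s i).comp (f := fun τ => (τ, x)) (contDiff_id.prodMk contDiff_const).contDiffOn
      fun _ _ => ⟨mem_univ _, hx⟩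
  exact (contDiffOn_univ.1 h1).differentiable (by simp) t

lemma IsSolution.differentiableAt_η (h : P.IsSolution u p η) (s : Side) (t : ℝ)
    (y : Fin 2 → ℝ) : DifferentiableAt ℝ (fun τ => η s τ y) t :=
  ((h.smooth_η s).comp (f := fun τ => (τ, y))
    (contDiff_id.prodMk contDiff_const)).differentiable (by simp) t

lemma lapStar_clm_comp (L : F →L[ℝ] G) {h : (Fin 2 → ℝ) → F} (hh : ContDiffOn ℝ ∞ h univ)
    (y : Fin 2 → ℝ) : lapStar (fun y => L (h y)) y = L (lapStar h y) := by
  unfold lapStar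
  rw [map_sum]
  refine Finset.sum_congr rfl fun j _ => ?_
  rw [pd_congr j (pd_clm_comp uniqueDiffOn_univ j L hh) (mem_univ y),
    pd_clm_comp uniqueDiffOn_univ j L (contDiffOn_pd uniqueDiffOn_univ j hh) (mem_univ y)]

lemma IsSolution.stress_clm_comp (h : P.IsSolution u p η) (L : F →L[ℝ] G) (s : Side) (t : ℝ)
    (i : Fin 3) {x : Fin 3 → ℝ} (hx : x ∈ P.slab s) :
    P.stress s (fun x i => L (u s t x i)) (fun x => L (p s t x)) i x
      = L (P.stress s (u s t) (p s t) i x) := by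
  have hS := P.uniqueDiffOn_slab s
  unfold stress symGrad
  rw [pd_clm_comp hS 2 L (h.contDiffOn_u s t i) hx, pd_clm_comp hS i L (h.contDiffOn_u s t 2) hx]
  split_ifs <;> simp

/-- A real linear map applied to a solution gives a solution. -/
lemma IsSolution.clm_comp (h : P.IsSolution u p η) (L : F →L[ℝ] G) :
    P.IsSolution (fun s t x i => L (u s t x i)) (fun s t x => L (p s t x))
      (fun s t y => L (η s t y)) where
  smooth_u s i := L.contDiff.comp_contDiffOn (h.smooth_u s i)
  smooth_p s := L.contDiff.comp_contDiffOn (h.smooth_p s)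
  smooth_η s := L.contDiff.comp (h.smooth_η s)
  periodic_u s t x hx := by
    obtain ⟨h1, h2⟩ := h.periodic_u s t x hx
    simp only [h1, h2, and_self]
  periodic_p s t x hx := by
    obtain ⟨h1, h2⟩ := h.periodic_p s t x hx
    simp only [h1, h2, and_self]
  periodic_η s t y := by
    obtain ⟨h1, h2⟩ := h.periodic_η s t y
    simp only [h1, h2, and_self]
  momentum s t x hx i := by
    have hS := P.uniqueDiffOn_slab s
    have hx' := P.openSlab_subset s hx
    have h1 := h.momentum s t x hx i
    have h2 : deriv (fun τ => L (u s τ x i)) t = L (deriv (fun τ => u s τ x i) t) :=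
      (L.hasFDerivAt.comp_hasDerivAt t (h.differentiableAt_u s t hx' i).hasDerivAt).deriv
    have h3 : ∀ j, pd (P.slab s) j (pd (P.slab s) j fun z => L (u s t z i)) x
        = L (pd (P.slab s) j (pd (P.slab s) j fun z => u s t z i) x) := fun j => by
      rw [pd_congr j (pd_clm_comp hS j L (h.contDiffOn_u s t i)) hx',
        pd_clm_comp hS j L (contDiffOn_pd hS j (h.contDiffOn_u s t i)) hx']
    rw [h2, pd_clm_comp hS i L (h.contDiffOn_p s t) hx', Finset.sum_congr rfl fun j _ => h3 j,
      ← map_sum, ← map_smul, ← map_smul, ← map_sub, ← map_add, h1, map_zero]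
  div_free s t x hx := by
    have hx' := P.openSlab_subset s hx
    rw [Finset.sum_congr rfl fun j _ => pd_clm_comp (P.uniqueDiffOn_slab s) j L
      (h.contDiffOn_u s t j) hx', ← map_sum, h.div_free s t x hx, map_zero]
  kinematic s t y := by
    rw [← h.kinematic s t y]
    exact (L.hasFDerivAt.comp_hasDerivAt t (h.differentiableAt_η s t y).hasDerivAt).deriv
  stress_top t y i := by
    rw [h.stress_clm_comp L .upper t i (P.at_mem_slab (h := 1) ⟨zero_le_one, le_rfl⟩ y), h.stress_top,
      lapStar_clm_comp L (h.contDiffOn_η _ t)]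
    split_ifs <;> simp
  jump_u t y := by
    funext i
    simp only [h.jump_u t y]
  jump_stress t y i := by
    rw [h.stress_clm_comp L .upper t i (P.at_mem_slab (h := 0) ⟨le_rfl, zero_le_one⟩ y),
      h.stress_clm_comp L .lower t i (P.at_mem_slab (s := .lower) (h := 0) ⟨neg_nonpos.2 P.hb.le, le_rfl⟩ y),
      ← map_sub, h.jump_stress, lapStar_clm_comp L (h.contDiffOn_η _ t)]
    split_ifs <;> simp
  no_slip t y := by
    funext i
    simp only [h.no_slip t y, Pi.zero_apply, map_zero]

/-- A solution proportional to `e^{lam t}`, with nonzero velocity and surface functions, grows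
exactly. -/
lemma IsSolution.isGrowingSolution (h : P.IsSolution u p η) {lam : ℝ}
    (hu : ∀ s t x i, u s t x i = Real.exp (lam * t) • u s 0 x i)
    (hη : ∀ s t y, η s t y = Real.exp (lam * t) • η s 0 y)
    {x : Fin 3 → ℝ} (hx : x ∈ P.cell .lower) {i : Fin 3} (hux : u .lower 0 x i ≠ 0)
    {y : Fin 2 → ℝ} (hy : y ∈ P.torusCell) (hηy : η .lower 0 y ≠ 0) :
    P.IsGrowingSolution lam u p η where
  solution := h
  memHk_u k s t i := memHk_of_contDiffOn (P.uniqueDiffOn_slab s) (P.isOpen_cell s).measurableSet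
    (P.cell_subset s) isCompact_Icc (P.box_subset_slab s) (h.contDiffOn_u s t i) k
  memHk_p k s t := memHk_of_contDiffOn (P.uniqueDiffOn_slab s) (P.isOpen_cell s).measurableSet
    (P.cell_subset s) isCompact_Icc (P.box_subset_slab s) (h.contDiffOn_p s t) k
  memHk_η k s t := memHk_of_contDiffOn uniqueDiffOn_univ P.isOpen_torusCell.measurableSet
    P.torusCell_subset isCompact_Icc (subset_univ _) (h.contDiffOn_η s t) k
  pos_η k := by
    refine Real.sqrt_pos.2 (add_pos_of_nonneg_of_pos (hkNormSq_nonneg _ _ _ _) ?_)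
    exact hkNormSq_pos uniqueDiffOn_univ P.isOpen_torusCell P.torusCell_subset isCompact_Icc
      (subset_univ _) (h.contDiffOn_η _ 0) hy hηy k
  pos_u k := by
    refine Real.sqrt_pos.2 (add_pos_of_nonneg_of_pos
      (Finset.sum_nonneg fun _ _ => hkNormSq_nonneg _ _ _ _) ?_)
    refine Finset.sum_pos' (fun _ _ => hkNormSq_nonneg _ _ _ _) ⟨i, Finset.mem_univ _, ?_⟩
    exact hkNormSq_pos (P.uniqueDiffOn_slab _) (P.isOpen_cell _) (P.cell_subset _) isCompact_Icc
      (P.box_subset_slab _) (h.contDiffOn_u _ 0 i) hx hux k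
  growth_η k t := by
    have key : ∀ s, hkNormSq univ P.torusCell k (η s t)
        = Real.exp (lam * t) ^ 2 * hkNormSq univ P.torusCell k (η s 0) := fun s => by
      rw [← hkNormSq_smul uniqueDiffOn_univ P.isOpen_torusCell.measurableSet (subset_univ _)
        (h.contDiffOn_η s 0), ← funext (hη s t)]
    simp only [surfNorm, key]
    rw [← mul_add, Real.sqrt_mul (by positivity), Real.sqrt_sq (Real.exp_pos _).le]
  growth_u k t := by
    have key : ∀ s i, hkNormSq (P.slab s) (P.cell s) k (fun x => u s t x i)
        = Real.exp (lam * t) ^ 2 * hkNormSq (P.slab s) (P.cell s) k (fun x => u s 0 x i) :=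
      fun s i => by
        rw [← hkNormSq_smul (P.uniqueDiffOn_slab s) (P.isOpen_cell s).measurableSet
          ((P.cell_subset s).trans (P.box_subset_slab s)) (h.contDiffOn_u s 0 i),
          ← funext fun x => hu s t x i]
    simp only [bulkNorm, key]
    rw [← Finset.mul_sum, ← Finset.mul_sum, ← mul_add, Real.sqrt_mul (by positivity),
      Real.sqrt_sq (Real.exp_pos _).le]

end Solutions

end Params

/-! ### Plane waves -/

/-- The function `V(x₃) e^{i x'·ξ} e^{lam t}`. -/
def planeMode (lam : ℝ) (ξ : Fin 2 → ℝ) (V : ℝ → ℂ) (t : ℝ) (x : Fin 3 → ℝ) : ℂ :=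
  V (x 2) * wave lam ξ t (x 0) (x 1)

section Wave

variable (lam : ℝ) (ξ : Fin 2 → ℝ)

lemma hasDerivAt_wave_time (t x₁ x₂ : ℝ) :
    HasDerivAt (fun t => wave lam ξ t x₁ x₂) ((lam : ℂ) * wave lam ξ t x₁ x₂) t := by
  have h1 : HasDerivAt (fun t : ℝ => ((lam * t : ℝ) : ℂ)) ((lam : ℝ) : ℂ) t := by
    have : HasDerivAt (fun t : ℝ => lam * t) lam t := by
      simpa using (hasDerivAt_id t).const_mul lam
    exact this.ofReal_comp
  exact (h1.cexp.mul_const _).congr_deriv (by unfold wave; ring)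

lemma hasDerivAt_wave_fst (t x₁ x₂ : ℝ) :
    HasDerivAt (fun x => wave lam ξ t x x₂) (Complex.I * ξ 0 * wave lam ξ t x₁ x₂) x₁ := by
  have h1 : HasDerivAt (fun x : ℝ => ((x * ξ 0 + x₂ * ξ 1 : ℝ) : ℂ)) ((ξ 0 : ℝ) : ℂ) x₁ := by
    have : HasDerivAt (fun x : ℝ => x * ξ 0 + x₂ * ξ 1) (ξ 0) x₁ := by
      simpa using ((hasDerivAt_id x₁).mul_const (ξ 0)).add_const (x₂ * ξ 1)
    exact this.ofReal_comp
  exact ((h1.const_mul Complex.I).cexp.const_mul _).congr_deriv (by unfold wave; ring)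

lemma hasDerivAt_wave_snd (t x₁ x₂ : ℝ) :
    HasDerivAt (fun x => wave lam ξ t x₁ x) (Complex.I * ξ 1 * wave lam ξ t x₁ x₂) x₂ := by
  have h1 : HasDerivAt (fun x : ℝ => ((x₁ * ξ 0 + x * ξ 1 : ℝ) : ℂ)) ((ξ 1 : ℝ) : ℂ) x₂ := by
    have : HasDerivAt (fun x : ℝ => x₁ * ξ 0 + x * ξ 1) (ξ 1) x₂ := by
      simpa using ((hasDerivAt_id x₂).mul_const (ξ 1)).const_add (x₁ * ξ 0)
    exact this.ofReal_comp
  exact ((h1.const_mul Complex.I).cexp.const_mul _).congr_deriv (by unfold wave; ring)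

lemma wave_eq_smul (t x₁ x₂ : ℝ) :
    wave lam ξ t x₁ x₂ = Real.exp (lam * t) • wave lam ξ 0 x₁ x₂ := by
  simp [wave]

lemma contDiff_wave : ContDiff ℝ ∞ fun q : ℝ × ℝ × ℝ => wave lam ξ q.1 q.2.1 q.2.2 := by
  have h1 : ContDiff ℝ ∞ fun q : ℝ × ℝ × ℝ => ((lam * q.1 : ℝ) : ℂ) :=
    Complex.ofRealCLM.contDiff.comp (contDiff_const.mul contDiff_fst)
  have h2 : ContDiff ℝ ∞ fun q : ℝ × ℝ × ℝ => ((q.2.1 * ξ 0 + q.2.2 * ξ 1 : ℝ) : ℂ) :=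
    Complex.ofRealCLM.contDiff.comp ((contDiff_snd.fst.mul contDiff_const).add
      (contDiff_snd.snd.mul contDiff_const))
  exact h1.cexp.mul (contDiff_const.mul h2).cexp

lemma contDiff_planeMode {V : ℝ → ℂ} (hV : ContDiff ℝ ∞ V) :
    ContDiff ℝ ∞ fun q : ℝ × (Fin 3 → ℝ) => planeMode lam ξ V q.1 q.2 := by
  have hproj : ∀ i : Fin 3, ContDiff ℝ ∞ fun q : ℝ × (Fin 3 → ℝ) => q.2 i := fun i =>
    (contDiff_apply ℝ ℝ i).comp contDiff_snd
  exact (hV.comp (hproj 2)).mul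
    ((contDiff_wave lam ξ).comp (contDiff_fst.prodMk ((hproj 0).prodMk (hproj 1))))

/-- A partial derivative of a globally differentiable function is the derivative along a line. -/
lemma pd_eq_of_hasDerivAt {n : ℕ} {S : Set (Fin n → ℝ)} (hS : UniqueDiffOn ℝ S)
    {f : (Fin n → ℝ) → ℂ} {x : Fin n → ℝ} (hx : x ∈ S) (hf : DifferentiableAt ℝ f x) {j : Fin n}
    {d : ℂ} (hd : HasDerivAt (fun τ => f (Function.update x j τ)) d (x j)) : pd S j f x = d := by
  unfold pd
  rw [hf.fderivWithin (hS x hx)]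
  have h1 : HasDerivAt (Function.update x j) (Pi.single j 1) (x j) := hasDerivAt_update x j (x j)
  have h2 : HasFDerivAt f (fderiv ℝ f x) (Function.update x j (x j)) := by
    rw [Function.update_eq_self]
    exact hf.hasFDerivAt
  exact (h2.comp_hasDerivAt (x j) h1).unique hd

variable {S : Set (Fin 3 → ℝ)} {u : (Fin 3 → ℝ) → ℂ} {V V' : ℝ → ℂ} {t : ℝ}

/-- The profile of the `j`-th partial derivative of the plane wave with profile `V`, where `V'` is
the derivative of `V`. -/
def profileDeriv (ξ : Fin 2 → ℝ) (V V' : ℝ → ℂ) (j : Fin 3) : ℝ → ℂ :=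
  ![fun z => Complex.I * ξ 0 * V z, fun z => Complex.I * ξ 1 * V z, V'] j

lemma pd_planeMode (hS : UniqueDiffOn ℝ S) (hV : ContDiff ℝ ∞ V)
    (hV' : ∀ z, HasDerivAt V (V' z) z) (hu : EqOn u (planeMode lam ξ V t) S) (j : Fin 3) :
    EqOn (pd S j u) (planeMode lam ξ (profileDeriv ξ V V' j) t) S := by
  refine (pd_congr j hu).trans fun x hx => ?_
  have hd : DifferentiableAt ℝ (planeMode lam ξ V t) x :=
    ((contDiff_planeMode lam ξ hV).comp (f := fun x => (t, x))
      (contDiff_const.prodMk contDiff_id)).differentiable (by simp) x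
  refine pd_eq_of_hasDerivAt hS hx hd ?_
  fin_cases j
  · simpa [planeMode, profileDeriv, mul_assoc, mul_left_comm] using
      (hasDerivAt_wave_fst lam ξ t (x 0) (x 1)).const_mul (V (x 2))
  · simpa [planeMode, profileDeriv, mul_assoc, mul_left_comm] using
      (hasDerivAt_wave_snd lam ξ t (x 0) (x 1)).const_mul (V (x 2))
  · simpa [planeMode, profileDeriv] using
      (hV' (x 2)).mul_const (wave lam ξ t (x 0) (x 1))

lemma contDiff_profileDeriv (hV : ContDiff ℝ ∞ V) (hV' : ContDiff ℝ ∞ V') (j : Fin 3) :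
    ContDiff ℝ ∞ (profileDeriv ξ V V' j) := by
  fin_cases j
  · exact contDiff_const.mul hV
  · exact contDiff_const.mul hV
  · exact hV'

/-- The Laplacian of a plane wave. -/
lemma sum_pd_pd_planeMode {V'' : ℝ → ℂ} (hS : UniqueDiffOn ℝ S) (hV : ContDiff ℝ ∞ V)
    (hVs : ContDiff ℝ ∞ V') (hV' : ∀ z, HasDerivAt V (V' z) z)
    (hV'' : ∀ z, HasDerivAt V' (V'' z) z) (hu : EqOn u (planeMode lam ξ V t) S)
    {x : Fin 3 → ℝ} (hx : x ∈ S) :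
    ∑ j : Fin 3, pd S j (pd S j u) x =
      (V'' (x 2) - ((ξ 0 ^ 2 + ξ 1 ^ 2 : ℝ) : ℂ) * V (x 2)) * wave lam ξ t (x 0) (x 1) := by
  have h0 := pd_planeMode lam ξ hS (contDiff_profileDeriv ξ hV hVs 0)
    (V' := profileDeriv ξ V' V'' 0) (fun z => (hV' z).const_mul _)
    (pd_planeMode lam ξ hS hV hV' hu 0) 0 hx
  have h1 := pd_planeMode lam ξ hS (contDiff_profileDeriv ξ hV hVs 1)
    (V' := profileDeriv ξ V' V'' 1) (fun z => (hV' z).const_mul _)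
    (pd_planeMode lam ξ hS hV hV' hu 1) 1 hx
  have h2 := pd_planeMode lam ξ hS (contDiff_profileDeriv ξ hV hVs 2)
    (V' := profileDeriv ξ V' V'' 2) hV'' (pd_planeMode lam ξ hS hV hV' hu 2) 2 hx
  rw [Fin.sum_univ_three, h0, h1, h2]
  simp only [planeMode, profileDeriv, Matrix.cons_val]
  push_cast
  linear_combination ((ξ 0 : ℂ) ^ 2 + (ξ 1 : ℂ) ^ 2) * V (x 2) * wave lam ξ t (x 0) (x 1)
    * Complex.I_sq

lemma lapStar_wave (c : ℂ) (t : ℝ) (y : Fin 2 → ℝ) :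
    Params.lapStar (fun y : Fin 2 → ℝ => c * wave lam ξ t (y 0) (y 1)) y
      = -(((ξ 0 ^ 2 + ξ 1 ^ 2 : ℝ) : ℂ) * (c * wave lam ξ t (y 0) (y 1))) := by
  have hsm : ∀ c : ℂ, ContDiff ℝ ∞ fun y : Fin 2 → ℝ => c * wave lam ξ t (y 0) (y 1) := fun c =>
    contDiff_const.mul ((contDiff_wave lam ξ).comp (contDiff_const.prodMk
      ((contDiff_apply ℝ ℝ 0).prodMk (contDiff_apply ℝ ℝ 1))))
  have hpd : ∀ (c : ℂ) (j : Fin 2), pd univ j (fun y : Fin 2 → ℝ => c * wave lam ξ t (y 0) (y 1))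
      = fun y => (c * (Complex.I * ξ j)) * wave lam ξ t (y 0) (y 1) := by
    intro c j
    funext y
    refine pd_eq_of_hasDerivAt uniqueDiffOn_univ (mem_univ y)
      ((hsm c).differentiable (by simp) y) ?_
    fin_cases j
    · simpa [mul_assoc] using (hasDerivAt_wave_fst lam ξ t (y 0) (y 1)).const_mul c
    · simpa [mul_assoc] using (hasDerivAt_wave_snd lam ξ t (y 0) (y 1)).const_mul c
  unfold Params.lapStar
  simp only [hpd, Fin.sum_univ_two]
  push_cast
  linear_combination ((ξ 0 : ℂ) ^ 2 + (ξ 1 : ℂ) ^ 2) * c * wave lam ξ t (y 0) (y 1)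
    * Complex.I_sq

end Wave

lemma wave_add_period (lam t x₁ x₂ : ℝ) (P : Params) (m : Fin 2 → ℤ) :
    wave lam (P.freq m) t (x₁ + 2 * Real.pi * P.L₁) x₂ = wave lam (P.freq m) t x₁ x₂ ∧
    wave lam (P.freq m) t x₁ (x₂ + 2 * Real.pi * P.L₂) = wave lam (P.freq m) t x₁ x₂ := by
  have h1 := P.hL₁.ne'
  have h2 := P.hL₂.ne'
  unfold wave
  constructor
  · congr 1
    rw [Complex.exp_eq_exp_iff_exists_int]
    refine ⟨m 0, ?_⟩
    have e : (x₁ + 2 * Real.pi * P.L₁) * P.freq m 0 + x₂ * P.freq m 1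
        = (x₁ * P.freq m 0 + x₂ * P.freq m 1) + m 0 * (2 * Real.pi) := by
      simp only [Params.freq, Matrix.cons_val]
      field_simp
      ring
    rw [e]
    push_cast
    ring
  · congr 1
    rw [Complex.exp_eq_exp_iff_exists_int]
    refine ⟨m 1, ?_⟩
    have e : x₁ * P.freq m 0 + (x₂ + 2 * Real.pi * P.L₂) * P.freq m 1
        = (x₁ * P.freq m 0 + x₂ * P.freq m 1) + m 1 * (2 * Real.pi) := by
      simp only [Params.freq, Matrix.cons_val]
      field_simp
      ring
    rw [e]
    push_cast
    ring

namespace Params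

variable {P : Params}

/-! ### The normal mode of a solution of the boundary value problem -/

/-- The coefficients of one layer, from the pair for the upper and the lower layer. -/
def sideCoeff (a : (Fin 4 → ℝ) × (Fin 4 → ℝ)) : Side → Fin 4 → ℝ
  | .upper => a.1
  | .lower => a.2

lemma IsBvpSolution.profile_toFun {r s d : ℝ} {a : (Fin 4 → ℝ) × (Fin 4 → ℝ)}
    (h : P.IsBvpSolution r s d a) (j : Side) {z : ℝ} (hz : z ∈ Icc (P.bot j) (top j)) :
    h.profile.toFun z = P.layer r s j (sideCoeff a j) 0 z := by
  cases j
  · rcases hz.1.eq_or_lt with h0 | h0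
    · rw [← h0]
      simpa [profile, ZeroH2.glue, sideCoeff, bot] using h.jump₀.symm
    · have h0' : 0 < z := h0
      simp [profile, ZeroH2.glue, sideCoeff, h0']
  · have h0 : z ≤ 0 := hz.2
    simp [profile, ZeroH2.glue, sideCoeff, not_lt.2 h0]

lemma IsBvpSolution.profile_d1 {r s d : ℝ} {a : (Fin 4 → ℝ) × (Fin 4 → ℝ)}
    (h : P.IsBvpSolution r s d a) (j : Side) {z : ℝ} (hz : z ∈ Icc (P.bot j) (top j)) :
    h.profile.d1 z = P.layer r s j (sideCoeff a j) 1 z := by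
  cases j
  · rcases hz.1.eq_or_lt with h0 | h0
    · rw [← h0]
      simpa [profile, ZeroH2.glue, sideCoeff, bot] using h.jump₁.symm
    · have h0' : 0 < z := h0
      simp [profile, ZeroH2.glue, sideCoeff, h0']
  · have h0 : z ≤ 0 := hz.2
    simp [profile, ZeroH2.glue, sideCoeff, not_lt.2 h0]

variable (P)

/-- The `k`-th derivatives of the profiles `-iφ`, `-iθ`, `ψ` of the velocity in one layer. -/
def velProfile (r s : ℝ) (ξ : Fin 2 → ℝ) (a : (Fin 4 → ℝ) × (Fin 4 → ℝ)) (j : Side) (k : ℕ)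
    (i : Fin 3) : ℝ → ℂ :=
  ![fun z => Complex.I * ξ 0 / r ^ 2 * (P.layer r s j (sideCoeff a j) (k + 1) z : ℝ),
    fun z => Complex.I * ξ 1 / r ^ 2 * (P.layer r s j (sideCoeff a j) (k + 1) z : ℝ),
    fun z => (P.layer r s j (sideCoeff a j) k z : ℝ)] i

/-- The `k`-th derivative of the pressure profile in one layer. -/
def pressProfile (r s : ℝ) (a : (Fin 4 → ℝ) × (Fin 4 → ℝ)) (j : Side) (k : ℕ) (z : ℝ) : ℝ :=
  (P.mu j * (P.layer r s j (sideCoeff a j) (k + 3) z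
      - r ^ 2 * P.layer r s j (sideCoeff a j) (k + 1) z)
    - P.rho j * s * P.layer r s j (sideCoeff a j) (k + 1) z) / r ^ 2

variable {P}

section Profiles

variable (r s : ℝ) (ξ : Fin 2 → ℝ) (a : (Fin 4 → ℝ) × (Fin 4 → ℝ)) (j : Side)

lemma contDiff_layer (P : Params) (c : Fin 4 → ℝ) (k : ℕ) :
    ContDiff ℝ ∞ (P.layer r s j c k) := by
  unfold layer expSum
  fun_prop

lemma hasDerivAt_velProfile (k : ℕ) (i : Fin 3) (z : ℝ) :
    HasDerivAt (P.velProfile r s ξ a j k i) (P.velProfile r s ξ a j (k + 1) i z) z := by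
  fin_cases i
  · exact ((P.hasDerivAt_layer r s j _ (k + 1) z).ofReal_comp).const_mul _
  · exact ((P.hasDerivAt_layer r s j _ (k + 1) z).ofReal_comp).const_mul _
  · exact (P.hasDerivAt_layer r s j _ k z).ofReal_comp

lemma contDiff_velProfile (k : ℕ) (i : Fin 3) : ContDiff ℝ ∞ (P.velProfile r s ξ a j k i) := by
  have h : ∀ k, ContDiff ℝ ∞ fun z => (P.layer r s j (sideCoeff a j) k z : ℂ) := fun k =>
    Complex.ofRealCLM.contDiff.comp (contDiff_layer r s j P _ k)
  fin_cases i
  · exact contDiff_const.mul (h (k + 1))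
  · exact contDiff_const.mul (h (k + 1))
  · exact h k

lemma hasDerivAt_pressProfile (k : ℕ) (z : ℝ) :
    HasDerivAt (fun z => (P.pressProfile r s a j k z : ℂ))
      (P.pressProfile r s a j (k + 1) z : ℂ) z := by
  refine HasDerivAt.ofReal_comp ?_
  have hd := P.hasDerivAt_layer r s j (sideCoeff a j)
  exact ((((hd (k + 3) z).sub ((hd (k + 1) z).const_mul (r ^ 2))).const_mul (P.mu j)).sub
    ((hd (k + 1) z).const_mul (P.rho j * s))).div_const _

lemma contDiff_pressProfile (k : ℕ) :
    ContDiff ℝ ∞ (fun z => (P.pressProfile r s a j k z : ℂ)) := by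
  have hc := contDiff_layer r s j P (sideCoeff a j)
  exact Complex.ofRealCLM.contDiff.comp (((contDiff_const.mul ((hc (k + 3)).sub
    (contDiff_const.mul (hc (k + 1))))).sub (contDiff_const.mul (hc (k + 1)))).div_const _)

end Profiles

section Mode

variable {r s d : ℝ} {a : (Fin 4 → ℝ) × (Fin 4 → ℝ)} (h : P.IsBvpSolution r s d a)
  (ξ : Fin 2 → ℝ)

/-- The velocity of the normal mode. The horizontal profiles `φ = -ξ₁ ψ' / r²`, `θ = -ξ₂ ψ' / r²`
are parallel to `ξ`, and incompressibility determines them from `ψ`. -/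
def IsBvpSolution.velocity : Side → ℝ → (Fin 3 → ℝ) → Fin 3 → ℂ :=
  modeU s ξ (fun z => -(ξ 0 / r ^ 2 * h.profile.d1 z)) (fun z => -(ξ 1 / r ^ 2 * h.profile.d1 z))
    h.profile.toFun

lemma IsBvpSolution.velocity_eqOn (j : Side) (t : ℝ) (i : Fin 3) :
    EqOn (fun x => h.velocity ξ j t x i) (planeMode s ξ (P.velProfile r s ξ a j 0 i) t)
      (P.slab j) := by
  intro x hx
  have h0 := h.profile_toFun j hx
  have h1 := h.profile_d1 j hx
  fin_cases i
  · simp only [velocity, modeU, planeMode, velProfile, h1, Fin.zero_eta, Matrix.cons_val]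
    push_cast
    ring
  · simp only [velocity, modeU, planeMode, velProfile, h1, Fin.mk_one, Matrix.cons_val]
    push_cast
    ring
  · simp [velocity, modeU, planeMode, velProfile, h0]

/-- The traction of the normal mode on horizontal planes, in terms of the two fluxes. -/
lemma IsBvpSolution.stress_velocity (hr : r ≠ 0) (hs : s ≠ 0) (j : Side) (t : ℝ)
    {x : Fin 3 → ℝ} (hx : x ∈ P.slab j) (i : Fin 3) :
    P.stress j (h.velocity ξ j t) (modeP s ξ (fun j => P.pressProfile r s a j 0) j t) i x
      = ![-(Complex.I * ξ 0 / r ^ 2 * P.tangFlux r s j (sideCoeff a j) (x 2)),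
          -(Complex.I * ξ 1 / r ^ 2 * P.tangFlux r s j (sideCoeff a j) (x 2)),
          -((P.normFlux r s j (sideCoeff a j) (x 2) : ℂ) / (s * r ^ 2))] i
        * wave s ξ t (x 0) (x 1) := by
  have hS := P.uniqueDiffOn_slab j
  have hpd : ∀ i k : Fin 3, pd (P.slab j) k (fun x => h.velocity ξ j t x i) x = _ := fun i k =>
    pd_planeMode s ξ hS (contDiff_velProfile r s ξ a j 0 i)
      (hasDerivAt_velProfile r s ξ a j 0 i) (h.velocity_eqOn ξ j t i) k hx
  have hrc : (r : ℂ) ≠ 0 := by exact_mod_cast hr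
  have hsc : (s : ℂ) ≠ 0 := by exact_mod_cast hs
  unfold stress symGrad
  rw [hpd, hpd]
  simp only [planeMode, profileDeriv, modeP, tangFlux, normFlux, pressProfile, Complex.real_smul]
  fin_cases i
  · simp [velProfile]
    field_simp
    ring
  · simp [velProfile]
    field_simp
    ring
  · simp [velProfile]
    field_simp
    ring

lemma IsBvpSolution.isSolution {m : Fin 2 → ℤ} (hr : 0 < r) (hs : 0 < s)
    (hrm : r = P.freqAbs m)
    (hd : d = P.interfaceCoeff r * h.profile.toFun 0) :
    P.IsSolution (h.velocity (P.freq m))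
      (modeP s (P.freq m) fun j => P.pressProfile r s a j 0)
      (modeEta s (P.freq m) h.profile.toFun) := by
  set ξ := P.freq m with hξ
  have hr2 : ξ 0 ^ 2 + ξ 1 ^ 2 = r ^ 2 := by
    rw [hrm, freqAbs, Real.sq_sqrt (by positivity)]
  have hr2c : (ξ 0 : ℂ) ^ 2 + (ξ 1 : ℂ) ^ 2 = (r : ℂ) ^ 2 := by exact_mod_cast hr2
  have hrc : (r : ℂ) ≠ 0 := by exact_mod_cast hr.ne'
  have hsc : (s : ℂ) ≠ 0 := by exact_mod_cast hs.ne'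
  have hr1 : P.freq m 0 ^ 2 + P.freq m 1 ^ 2 = r ^ 2 := hr2
  have hpd : ∀ (j : Side) (t : ℝ) {x : Fin 3 → ℝ}, x ∈ P.slab j → ∀ i k : Fin 3,
      pd (P.slab j) k (fun x => h.velocity ξ j t x i) x = _ := fun j t x hx i k =>
    pd_planeMode s ξ (P.uniqueDiffOn_slab j) (contDiff_velProfile r s ξ a j 0 i)
      (hasDerivAt_velProfile r s ξ a j 0 i) (h.velocity_eqOn ξ j t i) k hx
  have hstress := fun (j : Side) (t : ℝ) {x : Fin 3 → ℝ} (hx : x ∈ P.slab j) =>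
    h.stress_velocity ξ hr.ne' hs.ne' j t hx
  refine
  { smooth_u := fun j i => ?_
    smooth_p := fun j => (contDiff_planeMode s ξ (contDiff_pressProfile r s a j 0)).contDiffOn
    smooth_η := fun j => ?_
    periodic_u := fun j t x _ => ?_
    periodic_p := fun j t x _ => ?_
    periodic_η := fun j t y => ?_
    momentum := fun j t x hx i => ?_
    div_free := fun j t x hx => ?_
    kinematic := fun j t y => ?_
    stress_top := fun t y i => ?_
    jump_u := fun t y => ?_
    jump_stress := fun t y i => ?_
    no_slip := fun t y => ?_ }
  · exact (contDiff_planeMode s ξ (contDiff_velProfile r s ξ a j 0 i)).contDiffOn.congr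
      fun q hq => h.velocity_eqOn ξ j q.1 i hq.2
  · exact contDiff_const.mul ((contDiff_wave s ξ).comp (contDiff_fst.prodMk
      (((contDiff_apply ℝ ℝ 0).comp contDiff_snd).prodMk
        ((contDiff_apply ℝ ℝ 1).comp contDiff_snd))))
  · obtain ⟨h1, h2⟩ := wave_add_period s t (x 0) (x 1) P m
    constructor <;> funext i <;>
      simp [velocity, modeU, h1, h2, hξ]
  · obtain ⟨h1, h2⟩ := wave_add_period s t (x 0) (x 1) P m
    constructor <;> simp [modeP, h1, h2, hξ]
  · obtain ⟨h1, h2⟩ := wave_add_period s t (y 0) (y 1) P m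
    constructor <;> simp [modeEta, h1, h2, hξ]
  · have hx' := P.openSlab_subset j hx
    have h1 : deriv (fun τ => h.velocity ξ j τ x i) t = s * planeMode s ξ
        (P.velProfile r s ξ a j 0 i) t x := by
      have h2 : (fun τ => h.velocity ξ j τ x i)
          = fun τ => planeMode s ξ (P.velProfile r s ξ a j 0 i) τ x := by
        funext τ
        exact h.velocity_eqOn ξ j τ i hx'
      rw [h2]
      unfold planeMode
      rw [((hasDerivAt_wave_time s ξ t (x 0) (x 1)).const_mul _).deriv]
      ring
    have h3 := sum_pd_pd_planeMode s ξ (P.uniqueDiffOn_slab j)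
      (contDiff_velProfile r s ξ a j 0 i) (contDiff_velProfile r s ξ a j 1 i)
      (hasDerivAt_velProfile r s ξ a j 0 i) (hasDerivAt_velProfile r s ξ a j 1 i)
      (h.velocity_eqOn ξ j t i) hx'
    have h4 : pd (P.slab j) i (modeP s ξ (fun j => P.pressProfile r s a j 0) j t) x = _ :=
      pd_planeMode s ξ (P.uniqueDiffOn_slab j) (contDiff_pressProfile r s a j 0)
        (hasDerivAt_pressProfile r s a j 0) (fun _ _ => rfl) i hx'
    rw [h1, h3, h4, hr2]
    have hode : (P.mu j : ℂ) * (P.layer r s j (sideCoeff a j) 4 (x 2)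
        - 2 * r ^ 2 * P.layer r s j (sideCoeff a j) 2 (x 2)
        + r ^ 4 * P.layer r s j (sideCoeff a j) 0 (x 2))
        = s * P.rho j * (P.layer r s j (sideCoeff a j) 2 (x 2)
          - r ^ 2 * P.layer r s j (sideCoeff a j) 0 (x 2)) := by
      exact_mod_cast P.layer_ode hs j (sideCoeff a j) (x 2)
    simp only [planeMode, profileDeriv, pressProfile, Complex.real_smul]
    fin_cases i
    · simp [velProfile]
      field_simp
      ring
    · simp [velProfile]
      field_simp
      ring
    · simp [velProfile]
      field_simp
      linear_combination wave s ξ t (x 0) (x 1) * hode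
  · have hx' := P.openSlab_subset j hx
    rw [Fin.sum_univ_three, hpd j t hx', hpd j t hx', hpd j t hx']
    simp only [planeMode, profileDeriv, velProfile, Matrix.cons_val]
    field_simp
    linear_combination (P.layer r s j (sideCoeff a j) 1 (x 2) * wave s ξ t (x 0) (x 1))
      * ((ξ 0 ^ 2 + ξ 1 ^ 2) * Complex.I_sq - hr2c)
  · have h1 := ((hasDerivAt_wave_time s ξ t (y 0) (y 1)).const_mul
      ((s⁻¹ * h.profile.toFun (top j) : ℝ) : ℂ)).deriv
    refine h1.trans ?_
    simp [velocity, modeU, at_]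
    field_simp
  · rw [hstress .upper t (P.at_mem_slab (s := .upper) (h := 1) ⟨zero_le_one, le_rfl⟩ y)]
    have e0 : h.profile.toFun 1 = P.layer r s .upper a.1 0 1 :=
      h.profile_toFun .upper ⟨zero_le_one, le_rfl⟩
    have e1 : (P.normFlux r s .upper a.1 1 : ℂ)
        + r ^ 2 * (P.σp * r ^ 2 + P.g * P.ρp) * P.layer r s .upper a.1 0 1 = 0 := by
      exact_mod_cast h.norm_top
    have e2 := h.tang_top
    unfold modeEta
    rw [lapStar_wave, hr2]
    simp only [at_, sideCoeff, top, Matrix.cons_val, e0, e2, Complex.real_smul]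
    fin_cases i
    · simp
    · simp
    · simp
      field_simp
      linear_combination -wave s ξ t (y 0) (y 1) * e1
  · funext i
    simp [velocity, modeU]
  · rw [hstress .upper t (P.at_mem_slab (s := .upper) (h := 0) ⟨le_rfl, zero_le_one⟩ y),
      hstress .lower t (P.at_mem_slab (s := .lower) (h := 0) ⟨neg_nonpos.2 P.hb.le, le_rfl⟩ y)]
    have e1 : (P.normFlux r s .lower a.2 0 : ℂ) - P.normFlux r s .upper a.1 0
        = r ^ 2 * (P.g * P.rhoJump - P.σm * r ^ 2) * h.profile.toFun 0 := by
      have := h.norm_jump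
      rw [hd, interfaceCoeff] at this
      exact_mod_cast this
    have e2 := h.tang_jump
    unfold modeEta
    rw [lapStar_wave, hr2]
    simp only [at_, sideCoeff, top, Matrix.cons_val, e2, Complex.real_smul]
    fin_cases i
    · simp
    · simp
    · simp
      field_simp
      linear_combination wave s ξ t (y 0) (y 1) * e1
  · funext i
    have hmem : (-P.b) ∈ Icc (P.bot .lower) (top .lower) := ⟨le_rfl, neg_nonpos.2 P.hb.le⟩
    have e0 := (h.profile_toFun .lower hmem).trans h.bot₀
    have e1 := (h.profile_d1 .lower hmem).trans h.bot₁
    fin_cases i <;> simp [velocity, modeU, at_, e0, e1]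

end Mode

end Params

namespace Params

variable {P : Params}

/-! ### Growing normal modes -/

lemma IsBvpSolution.smul {r s d : ℝ} {a : (Fin 4 → ℝ) × (Fin 4 → ℝ)}
    (h : P.IsBvpSolution r s d a) (c : ℝ) : P.IsBvpSolution r s (c * d) (c • a) := by
  obtain ⟨h1, h2, h3, h4, h5, h6, h7, h8⟩ := h
  simp only [tangFlux, normFlux] at h5 h6 h7 h8
  constructor <;> simp only [tangFlux, normFlux, layer, expSum_smul, Prod.smul_fst,
    Prod.smul_snd] <;> simp only [layer] at h1 h2 h3 h4 h5 h6 h7 h8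
  · rw [h1, mul_zero]
  · rw [h2, mul_zero]
  · rw [h3]
  · rw [h4]
  · linear_combination c * h5
  · linear_combination c * h6
  · linear_combination c * h7
  · linear_combination c * h8

lemma IsBvpSolution.profile_smul {r s d : ℝ} {a : (Fin 4 → ℝ) × (Fin 4 → ℝ)}
    (h : P.IsBvpSolution r s d a) (c : ℝ) : (h.smul c).profile = h.profile.smul c := by
  simp only [profile, ZeroH2.glue, ZeroH2.smul, layer, expSum_smul, Prod.smul_fst, Prod.smul_snd,
    mul_ite]

/-- A minimizer that solves the boundary value problem classically. -/
lemma IsGrowthRate.exists_minimizer {r s : ℝ} (hr : P.IsSubcritical r)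
    (hs : P.IsGrowthRate r s) : ∃ (d : ℝ) (a : (Fin 4 → ℝ) × (Fin 4 → ℝ))
      (h : P.IsBvpSolution r s d a), d = P.interfaceCoeff r * h.profile.toFun 0 ∧
        h.profile.toFun 0 ≠ 0 ∧ P.IsMinimizer r s h.profile := by
  obtain ⟨a, h⟩ := P.exists_isBvpSolution hr.1 hs.1 1
  obtain ⟨h0, h1, h2⟩ := hs.of_representative hr (w := h.profile) fun χ => by
    rw [h.form_profile hs.1, one_mul]
  have hJ := P.constr_pos_of_ne_zero hr.1 h.profile P.zero_mem_Icc h0.ne'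
  set c := (Real.sqrt (P.constr r h.profile))⁻¹ with hc
  have hc0 : c ≠ 0 := inv_ne_zero (Real.sqrt_pos.2 hJ).ne'
  have e : (h.smul c).profile.toFun 0 = c * h.profile.toFun 0 := by
    rw [h.profile_smul]
    rfl
  refine ⟨c * 1, c • a, h.smul c, ?_, ?_, ?_⟩
  · rw [e]
    linear_combination -c * h1
  · rw [e]
    exact mul_ne_zero hc0 h0.ne'
  · rw [h.profile_smul]
    exact h2

/-- Near a corner of the period cell the real part of a plane wave does not vanish. -/
lemma exists_mem_torusCell_re_wave_pos (lam : ℝ) (m : Fin 2 → ℤ) :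
    ∃ y ∈ P.torusCell, 0 < (wave lam (P.freq m) 0 (y 0) (y 1)).re := by
  have h1 := P.hL₁
  have h2 := P.hL₂
  set N : ℝ := m 0 + m 1 with hN
  set τ : ℝ := 1 / (1 + |N|) with hτ
  have hpos : 0 < 1 + |N| := by positivity
  have hτ0 : 0 < τ := by positivity
  have hτ1 : τ ≤ 1 := (div_le_one hpos).2 (by linarith [abs_nonneg N])
  have hτN : |τ * N| ≤ 1 := by
    rw [abs_mul, abs_of_pos hτ0, hτ, one_div, inv_mul_le_iff₀ hpos]
    linarith
  have hπ := Real.pi_gt_three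
  refine ⟨![τ * P.L₁, τ * P.L₂], ⟨⟨mul_pos hτ0 h1, ?_⟩, ⟨mul_pos hτ0 h2, ?_⟩⟩, ?_⟩
  · exact mul_lt_mul_of_pos_right (by linarith) h1
  · exact mul_lt_mul_of_pos_right (by linarith) h2
  · have e : τ * P.L₁ * P.freq m 0 + τ * P.L₂ * P.freq m 1 = τ * N := by
      simp only [freq, Matrix.cons_val, hN]
      field_simp
    have e2 : (wave lam (P.freq m) 0 (τ * P.L₁) (τ * P.L₂)).re = Real.cos (τ * N) := by
      rw [wave, e, mul_comm Complex.I, mul_zero, Complex.ofReal_zero, Complex.exp_zero, one_mul,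
        Complex.exp_ofReal_mul_I_re]
    simp only [Matrix.cons_val]
    rw [e2]
    obtain ⟨h3, h4⟩ := abs_le.1 hτN
    exact Real.cos_pos_of_mem_Ioo ⟨by linarith, by linarith⟩

/-- Every growth rate of an admissible frequency is the rate of a growing normal mode. -/
lemma hasGrowingMode {lam : ℝ} (hlam : lam ∈ P.growthRates) : P.HasGrowingMode lam := by
  obtain ⟨m, hm, hs⟩ := hlam
  obtain ⟨d, a, h, hd, hne, hmin⟩ := hs.exists_minimizer hm
  have hsol := h.isSolution hm.1 hs.1 rfl hd
  have hu : ∀ j t x i, h.velocity (P.freq m) j t x i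
      = Real.exp (lam * t) • h.velocity (P.freq m) j 0 x i := by
    intro j t x i
    simp only [IsBvpSolution.velocity, modeU]
    rw [wave_eq_smul, Complex.real_smul, Complex.real_smul]
    ring
  have hη : ∀ j t y, modeEta lam (P.freq m) h.profile.toFun j t y
      = Real.exp (lam * t) • modeEta lam (P.freq m) h.profile.toFun j 0 y := by
    intro j t y
    simp only [modeEta]
    rw [wave_eq_smul, Complex.real_smul, Complex.real_smul]
    ring
  obtain ⟨y, hy, hwave⟩ := exists_mem_torusCell_re_wave_pos (P := P) lam m
  have hb := P.hb
  -- By continuity the profile does not vanish just below the interface.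
  obtain ⟨z, hz, hz0⟩ : ∃ z ∈ Ioo (-P.b) 0, h.profile.toFun z ≠ 0 := by
    have hc := (h.profile.continuousOn_toFun hb).continuousAt
      (Icc_mem_nhds (by linarith) one_pos) (x := 0)
    have h1 := (hc.eventually_ne hne).filter_mono (nhdsWithin_le_nhds (s := Iio 0))
    obtain ⟨z, hz1, hz2⟩ := (h1.and (Ioo_mem_nhdsLT (show -P.b < 0 by linarith))).exists
    exact ⟨z, hz2, hz1⟩
  have hx : ![y 0, y 1, z] ∈ P.cell .lower := ⟨⟨hy.1, hy.2⟩, hz⟩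
  have hure : (h.velocity (P.freq m) .lower 0 ![y 0, y 1, z] 2).re ≠ 0 := by
    simp only [IsBvpSolution.velocity, modeU, Matrix.cons_val, Complex.re_ofReal_mul]
    exact mul_ne_zero hz0 hwave.ne'
  have hηre : (modeEta lam (P.freq m) h.profile.toFun .lower 0 y).re ≠ 0 := by
    simp only [modeEta, top, Complex.re_ofReal_mul]
    exact mul_ne_zero (mul_ne_zero (inv_ne_zero hs.1.ne') hne) hwave.ne'
  refine ⟨m, h.profile, _, _, _, hm, hs, hmin,
    hsol.isGrowingSolution hu hη hx (i := 2) (fun h0 => hure ?_) hy (fun h0 => hηre ?_),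
    (hsol.clm_comp Complex.reCLM).isGrowingSolution (fun j t x i => ?_) (fun j t y => ?_) hx
      (i := 2) hure hy hηre⟩
  · rw [h0, Complex.zero_re]
  · rw [h0, Complex.zero_re]
  · rw [hu j t x i, map_smul]
  · rw [hη j t y, map_smul]

/-! ### The largest growth rate -/

lemma pos_of_mem_growthRates {s : ℝ} (hs : s ∈ P.growthRates) : 0 < s := by
  obtain ⟨m, -, h⟩ := hs
  exact h.1

lemma isLUB_lam (hne : P.growthRates.Nonempty) : IsLUB P.growthRates P.Lam :=
  isLUB_csSup hne P.bddAbove_growthRates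

lemma lam_pos (hne : P.growthRates.Nonempty) : 0 < P.Lam := by
  obtain ⟨s, hs⟩ := hne
  exact (pos_of_mem_growthRates hs).trans_le ((isLUB_lam ⟨s, hs⟩).1 hs)

lemma growthRates_nonempty {m : Fin 2 → ℤ} (hm : P.IsSubcritical (P.freqAbs m)) :
    P.growthRates.Nonempty := by
  obtain ⟨s, hs⟩ := hm.exists_isGrowthRate
  exact ⟨s, m, hm, hs⟩

lemma freqAbs_single_zero : P.freqAbs ![1, 0] = P.L₁⁻¹ := by
  have := P.hL₁
  simp [freqAbs, freq, Real.sqrt_sq this.le]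

lemma freqAbs_single_one : P.freqAbs ![0, 1] = P.L₂⁻¹ := by
  have := P.hL₂
  simp [freqAbs, freq, Real.sqrt_sq this.le]

lemma growthRates_nonempty_of_sigmaM_eq_zero (h : P.σm = 0) : P.growthRates.Nonempty :=
  growthRates_nonempty (m := ![1, 0])
    ⟨by rw [freqAbs_single_zero]; exact inv_pos.2 P.hL₁, fun h' => absurd h h'⟩

lemma growthRates_nonempty_of_lt_sigmaC (h0 : 0 < P.σm) (h : P.σm < P.sigmaC) :
    P.growthRates.Nonempty := by
  have key : ∀ {L : ℝ}, 0 < L → P.σm < P.g * P.rhoJump * L ^ 2 → P.IsSubcritical L⁻¹ := by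
    intro L hL hlt
    refine ⟨inv_pos.2 hL, fun _ => ?_⟩
    rw [Real.lt_sqrt (inv_pos.2 hL).le, lt_div_iff₀ h0, inv_pow, inv_mul_lt_iff₀ (by positivity)]
    linarith
  unfold sigmaC at h
  rcases max_choice (P.L₁ ^ 2) (P.L₂ ^ 2) with hmax | hmax <;> rw [hmax] at h
  · refine growthRates_nonempty (m := ![1, 0]) ?_
    rw [freqAbs_single_zero]
    exact key P.hL₁ h
  · refine growthRates_nonempty (m := ![0, 1]) ?_
    rw [freqAbs_single_one]
    exact key P.hL₂ h

lemma finite_freqAbs_lt (P : Params) (R : ℝ) : {m : Fin 2 → ℤ | P.freqAbs m < R}.Finite := by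
  have h1 := P.hL₁
  have h2 := P.hL₂
  refine (Set.finite_Icc ![-⌈R * P.L₁⌉, -⌈R * P.L₂⌉] ![⌈R * P.L₁⌉, ⌈R * P.L₂⌉]).subset ?_
  intro m hm
  have hm' : P.freqAbs m < R := hm
  have key : ∀ {i : Fin 2} {L : ℝ}, 0 < L → P.freq m i = m i / L → |P.freq m i| ≤ P.freqAbs m →
      -⌈R * L⌉ ≤ m i ∧ m i ≤ ⌈R * L⌉ := by
    intro i L hL he hle
    have h3 : |(m i : ℝ)| ≤ R * L := by
      have h4 : |(m i : ℝ)| / L ≤ R := by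
        rw [show |(m i : ℝ)| / L = |(m i : ℝ) / L| by rw [abs_div, abs_of_pos hL], ← he]
        exact hle.trans hm'.le
      exact (div_le_iff₀ hL).1 h4
    obtain ⟨h5, h6⟩ := abs_le.1 h3
    have h7 := Int.le_ceil (R * L)
    constructor
    · have : (-(⌈R * L⌉ : ℤ) : ℝ) ≤ m i := by linarith
      exact_mod_cast this
    · have : (m i : ℝ) ≤ (⌈R * L⌉ : ℤ) := by linarith
      exact_mod_cast this
  have k0 := key (i := 0) h1 rfl (Real.abs_le_sqrt (by nlinarith [sq_nonneg (P.freq m 1)]))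
  have k1 := key (i := 1) h2 rfl (Real.abs_le_sqrt (by nlinarith [sq_nonneg (P.freq m 0)]))
  refine ⟨fun i => ?_, fun i => ?_⟩ <;> fin_cases i
  exacts [k0.1, k1.1, k0.2, k1.2]

lemma finite_growthRates (h0 : 0 < P.σm) : P.growthRates.Finite := by
  classical
  have hfin := P.finite_freqAbs_lt (Real.sqrt (P.g * P.rhoJump / P.σm))
  let rate : (Fin 2 → ℤ) → ℝ := fun m =>
    if h : ∃ s, P.IsGrowthRate (P.freqAbs m) s then h.choose else 0
  refine (hfin.image rate).subset ?_
  rintro s ⟨m, hm, hs⟩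
  refine ⟨m, hm.2 h0.ne', ?_⟩
  have hex : ∃ s, P.IsGrowthRate (P.freqAbs m) s := ⟨s, hs⟩
  simp only [rate, dif_pos hex]
  exact hex.choose_spec.unique hm.1 hs

end Params

end TwoFluid
end

theorem theorem2p4 (P : TwoFluid.Params) :
    (∀ r : ℝ, P.IsSubcritical r → ∃! s : ℝ, P.IsGrowthRate r s) ∧
    (0 < P.σm → P.σm < P.sigmaC →
      0 < P.Lam ∧ IsLUB P.growthRates P.Lam ∧ P.HasGrowingMode P.Lam) ∧
    (P.σm = 0 →
      0 < P.Lam ∧ IsLUB P.growthRates P.Lam ∧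
      (∃ lam ∈ P.growthRates, P.Lam / 2 < lam ∧ lam ≤ P.Lam) ∧
      ∀ lam ∈ P.growthRates, P.Lam / 2 < lam → lam ≤ P.Lam → P.HasGrowingMode lam) := by
  refine ⟨fun r hr => ?_, fun h0 h1 => ?_, fun h0 => ?_⟩
  · obtain ⟨s, hs⟩ := hr.exists_isGrowthRate
    exact ⟨s, hs, fun t ht => ht.unique hr.1 hs⟩
  · have hne := TwoFluid.Params.growthRates_nonempty_of_lt_sigmaC h0 h1
    exact ⟨TwoFluid.Params.lam_pos hne, TwoFluid.Params.isLUB_lam hne,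
      TwoFluid.Params.hasGrowingMode (hne.csSup_mem (TwoFluid.Params.finite_growthRates h0))⟩
  · have hne := TwoFluid.Params.growthRates_nonempty_of_sigmaM_eq_zero h0
    have hpos := TwoFluid.Params.lam_pos hne
    have hlub := TwoFluid.Params.isLUB_lam hne
    refine ⟨hpos, hlub, ?_, fun lam hlam _ _ => TwoFluid.Params.hasGrowingMode hlam⟩
    obtain ⟨lam, hlam, h1, h2⟩ := hlub.exists_between (half_lt_self hpos)
    exact ⟨lam, hlam, h1, h2⟩
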